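/- Let $T^N=\{\zeta\in\mathbb C^N : |\zeta_i|=1\}$ act on $\mathbb H^N\cong\mathbb C^N\times\mathbb C^N$ by $(z,w)\zeta=(z\zeta,w\zeta^{-1})$. Let $K\subset T^N$ be a connected (closed) subtorus with Lie algebra $k\subset t^N=\mathbb R^N$ and inclusion $\iota\colon k\to t^N$, let $K_{\mathbb C}$ be its complexification, let $T^n=T^N/K$, and let $u_1,\dots,u_N\in(t^N)^*$ be the standard dual basis. The hyperkähler moment map for $K$ is $$\mu_1(z,w)=\pi\sum_{i=1}^N(|z_i|^2-|w_i|^2)\,\iota^*u_i\in k^*,\qquad \mu_{\mathbb C}(z,w)=-2\pi\sqrt{-1}\sum_{i=1}^N z_iw_i\,\iota^*u_i\in k_{\mathbb C}^*,$$ and $X(\alpha,\beta)=(\mu_1^{-1}(\alpha)\cap\mu_{\mathbb C}^{-1}(\beta))/K$ for $(\alpha,\beta)\in k^*\times k_{\mathbb C}^*$, with its induced $T^n$-action. A point $(z,w)\in\mu_{\mathbb C}^{-1}(\beta)$ is called $\alpha$-semi-stable if $\alpha\in\sum_i\mathbb R_{\ge0}|z_i|^2\iota^*u_i+\sum_i\mathbb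 R_{\ge0}|w_i|^2(-\iota^*u_i)$. Write $\mu_{\mathbb C}^{-1}(\beta)^{\alpha\text{-}ss}/\!/K_{\mathbb C}$ for the quotient of the set of $\alpha$-semi-stable points that identifies points whose $K_{\mathbb C}$-orbits have intersecting closures in it. All points of $\mu_{\mathbb C}^{-1}(\beta)$ are $0$-semi-stable, and the natural map $X(0,\beta)\to\mu_{\mathbb C}^{-1}(\beta)/\!/K_{\mathbb C}$ is a bijection. The natural morphism $\pi_1\colon X(\alpha,\beta)\to X(0,\beta)$ is the composition of the natural map $X(\alpha,\beta)\to\mu_{\mathbb C}^{-1}(\beta)^{\alpha\text{-}ss}/\!/K_{\mathbb C}$, the map $\mu_{\mathbb C}^{-1}(\beta)^{\alpha\text{-}ss}/\!/K_{\mathbb C}\to\mu_{\mathbb C}^{-1}(\beta)/\!/K_{\mathbb C}$ induced by the inclusion, and the inverse of this bijection. For $\epsilon\colon\{1,\dots,N\}\to\{1,-1\}$ let $V_\epsilon$ be the set of $(z,w)$ with $w_i=0$ whenever $\epsilon(i)=1$ and $z_i=0$ whenever $\epsilon(i)=-1$. Set $M_\epsilon(\alpha)=(V_\epsilon\cap\mu_1^{-1}(\alpha))/K\subset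 X(\alpha,0)$ and $\Theta_{cpt}(\alpha)=\{\epsilon : M_\epsilon(\alpha)\text{ is compact}\}$. **Proposition.** Fix any $\alpha\in k^*$, and let $\pi_1\colon X(\alpha,0)\to X(0,0)$ be the natural morphism. Then: (1) $\pi_1^{-1}([0,0])$ is a $T^n$-equivariant deformation retract of $X(\alpha,0)$: there is a continuous $H\colon[0,1]\times X(\alpha,0)\to X(\alpha,0)$ such that each $H_t$ is $T^n$-equivariant, $H_0=\mathrm{id}$, $H_1$ has image in $\pi_1^{-1}([0,0])$, and every $H_t$ fixes $\pi_1^{-1}([0,0])$ pointwise. (2) If moreover $\iota^*u_i\neq0$ for all $i=1,\dots,N$, then $$\pi_1^{-1}([0,0])=\bigcup_{\epsilon\in\Theta_{cpt}(\alpha)}M_\epsilon(\alpha).$$ -/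

import Mathlib

open Topology Filter

namespace ToricHK

noncomputable section

/-! ### Tori -/

/-- A connected subtorus of `T^N`: a closed connected subgroup. -/
structure Subtorus (N : ℕ) extends Subgroup (Fin N → Circle) where
  isClosed' : IsClosed carrier
  isConnected' : IsConnected carrier

/-- The exponential map `t^N = ℝ^N → T^N`, whose kernel is the lattice `ℤ^N`. -/
def expT {N : ℕ} (X : Fin N → ℝ) : Fin N → Circle := fun i => Circle.exp (2 * Real.pi * X i)

/-- The map `X ↦ Exp (√-1 X)` from `t^N` to the complex torus. -/
def expI {N : ℕ} (X : Fin N → ℝ) : Fin N → ℂˣ := fun i =>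
  Units.mk0 (Complex.exp (2 * Real.pi * Complex.I * (Complex.I * X i))) (Complex.exp_ne_zero _)

/-- The inclusion of the real torus into the complex torus. -/
def toComplexTorus {N : ℕ} : (Fin N → Circle) →* (Fin N → ℂˣ) where
  toFun ζ := fun i => Circle.toUnits (ζ i)
  map_one' := by ext i; simp
  map_mul' a b := by ext i; simp

lemma norm_toComplexTorus {N : ℕ} (ζ : Fin N → Circle) (i : Fin N) :
    ‖(toComplexTorus ζ i : ℂ)‖ = 1 := Circle.norm_coe (ζ i)

lemma expT_zero {N : ℕ} : expT (0 : Fin N → ℝ) = 1 := by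
  funext i; simp [expT]

lemma expT_add {N : ℕ} (X Y : Fin N → ℝ) : expT (X + Y) = expT X * expT Y := by
  funext i; simp [expT, mul_add, Circle.exp_add]

lemma expI_zero {N : ℕ} : expI (0 : Fin N → ℝ) = 1 := by
  funext i; ext; simp [expI]

lemma expI_add {N : ℕ} (X Y : Fin N → ℝ) : expI (X + Y) = expI X * expI Y := by
  funext i; ext; simp [expI, mul_add, Complex.exp_add]

lemma expI_neg {N : ℕ} (X : Fin N → ℝ) : expI (-X) = (expI X)⁻¹ := by
  rw [eq_inv_iff_mul_eq_one, ← expI_add, neg_add_cancel, expI_zero]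

variable {N : ℕ} (K : Subtorus N)

/-- The Lie algebra `k ⊂ t^N` of `K`. -/
def Subtorus.lie : Submodule ℝ (Fin N → ℝ) where
  carrier := {X | ∀ t : ℝ, expT (t • X) ∈ K.toSubgroup}
  zero_mem' t := by rw [smul_zero, expT_zero]; exact one_mem _
  add_mem' {X Y} hX hY t := by rw [smul_add, expT_add]; exact mul_mem (hX t) (hY t)
  smul_mem' c X hX t := by rw [smul_smul]; exact hX _

/-- The complexification `K_ℂ = K · Exp (√-1 k)` of `K`. -/
def Subtorus.complexification : Subgroup (Fin N → ℂˣ) where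
  carrier := {ζ | ∃ κ ∈ K.toSubgroup, ∃ Y ∈ K.lie, ζ = toComplexTorus κ * expI Y}
  one_mem' := ⟨1, one_mem _, 0, zero_mem _, by rw [map_one, expI_zero, mul_one]⟩
  mul_mem' := by
    rintro _ _ ⟨κ, hκ, Y, hY, rfl⟩ ⟨κ', hκ', Y', hY', rfl⟩
    exact ⟨κ * κ', mul_mem hκ hκ', Y + Y', add_mem hY hY', by
      rw [map_mul, expI_add, mul_mul_mul_comm]⟩
  inv_mem' := by
    rintro _ ⟨κ, hκ, Y, hY, rfl⟩
    exact ⟨κ⁻¹, inv_mem hκ, -Y, neg_mem hY, by rw [map_inv, expI_neg, mul_inv]⟩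

/-- The quotient torus `T^n = T^N / K`. -/
abbrev Subtorus.quotientTorus : Type := (Fin N → Circle) ⧸ K.toSubgroup

/-! ### The quaternionic vector space and the moment maps -/

/-- `ℍ^N`, identified with `ℂ^N × ℂ^N` by `ξ = z + w I₂`. -/
abbrev HSpace (N : ℕ) : Type := (Fin N → ℂ) × (Fin N → ℂ)

/-- The action `(z, w) ζ = (z ζ, w ζ⁻¹)` of the complex torus on `ℍ^N`. -/
def actC (ζ : Fin N → ℂˣ) (p : HSpace N) : HSpace N :=
  (fun i => p.1 i * (ζ i : ℂ), fun i => p.2 i * (((ζ i)⁻¹ : ℂˣ) : ℂ))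

/-- The action of the real torus on `ℍ^N`. -/
def act (ζ : Fin N → Circle) (p : HSpace N) : HSpace N := actC (toComplexTorus ζ) p

/-- The element `ι^* u_i ∈ k^*`. -/
def Subtorus.u (i : Fin N) : Module.Dual ℝ K.lie :=
  K.lie.subtype.dualMap (LinearMap.proj i)

/-- The real moment map `μ₁ : ℍ^N → k^*`. -/
def mu1 (p : HSpace N) : Module.Dual ℝ K.lie :=
  Real.pi • ∑ i, (‖p.1 i‖ ^ 2 - ‖p.2 i‖ ^ 2) • K.u i

/-- The complex moment map `μ_ℂ : ℍ^N → k_ℂ^*`, where `k_ℂ^* = Hom_ℝ(k, ℂ)`. -/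
def muC (p : HSpace N) : K.lie →ₗ[ℝ] ℂ :=
  (-2 * Real.pi * Complex.I : ℂ) • ∑ i, (K.u i).smulRight (p.1 i * p.2 i)

/-! ### Toric hyperkähler varieties -/

lemma actC_one (p : HSpace N) : actC 1 p = p := by
  simp [actC]

lemma actC_mul (ζ η : Fin N → ℂˣ) (p : HSpace N) : actC (ζ * η) p = actC ζ (actC η p) := by
  refine Prod.ext ?_ ?_ <;> funext i <;> simp [actC] <;> ring

lemma act_one (p : HSpace N) : act 1 p = p := by rw [act, map_one, actC_one]

lemma act_mul (ζ η : Fin N → Circle) (p : HSpace N) : act (ζ * η) p = act ζ (act η p) := by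
  rw [act, map_mul, actC_mul]; rfl

lemma mu1_act (ζ : Fin N → Circle) (p : HSpace N) : mu1 K (act ζ p) = mu1 K p := by
  simp [mu1, act, actC, norm_toComplexTorus]

lemma muC_actC (ζ : Fin N → ℂˣ) (p : HSpace N) : muC K (actC ζ p) = muC K p := by
  have h : ∀ i, (actC ζ p).1 i * (actC ζ p).2 i = p.1 i * p.2 i := fun i => by
    simp only [actC]
    rw [mul_mul_mul_comm, Units.mul_inv, mul_one]
  simp only [muC, h]

/-- The level set `μ⁻¹(α, β)`. -/
def levelSet (α : Module.Dual ℝ K.lie) (β : K.lie →ₗ[ℝ] ℂ) : Set (HSpace N) :=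
  {p | mu1 K p = α ∧ muC K p = β}

/-- The orbit relation of `K` on `μ⁻¹(α, β)`. -/
def orbitSetoid (α : Module.Dual ℝ K.lie) (β : K.lie →ₗ[ℝ] ℂ) : Setoid (levelSet K α β) where
  r p q := ∃ κ ∈ K.toSubgroup, act κ p.1 = q.1
  iseqv :=
    { refl := fun p => ⟨1, one_mem _, act_one _⟩
      symm := by
        rintro p q ⟨κ, hκ, h⟩
        exact ⟨κ⁻¹, inv_mem hκ, by rw [← h, ← act_mul, inv_mul_cancel, act_one]⟩
      trans := by
        rintro p q r ⟨κ, hκ, h⟩ ⟨κ', hκ', h'⟩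
        exact ⟨κ' * κ, mul_mem hκ' hκ, by rw [act_mul, h, h']⟩ }

/-- The toric hyperkähler variety `X(α, β) = μ⁻¹(α, β) / K`. -/
def X (α : Module.Dual ℝ K.lie) (β : K.lie →ₗ[ℝ] ℂ) : Type := Quotient (orbitSetoid K α β)

/-- The quotient topology of the subspace topology on `μ⁻¹(α, β)`. -/
instance (α : Module.Dual ℝ K.lie) (β : K.lie →ₗ[ℝ] ℂ) : TopologicalSpace (X K α β) :=
  inferInstanceAs (TopologicalSpace (Quotient (orbitSetoid K α β)))

/-- The projection `(z, w) ↦ [z, w]`. -/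
def X.mk {α : Module.Dual ℝ K.lie} {β : K.lie →ₗ[ℝ] ℂ} (p : levelSet K α β) : X K α β :=
  Quotient.mk (orbitSetoid K α β) p

/-- The action of `T^N` on the level set `μ⁻¹(α, β)`. -/
def actLevel {α : Module.Dual ℝ K.lie} {β : K.lie →ₗ[ℝ] ℂ} (ζ : Fin N → Circle)
    (p : levelSet K α β) : levelSet K α β :=
  ⟨act ζ p.1, (mu1_act K ζ p.1).trans p.2.1, (muC_actC K _ p.1).trans p.2.2⟩

/-- The action `[z, w] [ζ] = [z ζ, w ζ⁻¹]` of `T^n = T^N / K` on `X(α, β)`. -/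
instance (α : Module.Dual ℝ K.lie) (β : K.lie →ₗ[ℝ] ℂ) :
    MulAction K.quotientTorus (X K α β) where
  smul g x := Quotient.liftOn₂ g x (fun ζ p => X.mk K (actLevel K ζ p)) (by
    intro ζ p ζ' p' hζ hp
    obtain ⟨κ, hκ, h⟩ := hp
    refine Quotient.sound ⟨(ζ⁻¹ * ζ') * κ, mul_mem (QuotientGroup.leftRel_apply.1 hζ) hκ, ?_⟩
    change act _ (act ζ p.1) = act ζ' p'.1
    rw [← h, ← act_mul, ← act_mul]
    congr 1
    rw [mul_right_comm, mul_right_comm ζ⁻¹, inv_mul_cancel, one_mul])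
  one_smul x := by
    induction x using Quotient.inductionOn with | _ p => ?_
    exact congrArg (X.mk K) (Subtype.ext (act_one p.1))
  mul_smul g h x := by
    induction g using Quotient.inductionOn with | _ ζ => ?_
    induction h using Quotient.inductionOn with | _ η => ?_
    induction x using Quotient.inductionOn with | _ p => ?_
    exact congrArg (X.mk K) (Subtype.ext (act_mul ζ η p.1))

lemma smul_mk {α : Module.Dual ℝ K.lie} {β : K.lie →ₗ[ℝ] ℂ} (ζ : Fin N → Circle)
    (p : levelSet K α β) :
    (QuotientGroup.mk ζ : K.quotientTorus) • X.mk K p = X.mk K (actLevel K ζ p) := rfl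

/-- The point `[0, 0]` of `X(0, 0)`. -/
def origin : X K 0 0 := X.mk K ⟨0, by simp [levelSet, mu1, muC]⟩

/-! ### GIT quotients -/

/-- The `K_ℂ`-orbit through a point of `ℍ^N`. -/
def orbitC (p : HSpace N) : Set (HSpace N) := {q | ∃ ζ ∈ K.complexification, actC ζ p = q}

/-- The set `μ_ℂ⁻¹(β)^{α-ss}` of `α`-semi-stable points, for arbitrary `α ∈ k^*`: those with
`α ∈ ∑ ℝ_{≥ 0} |z_i|² ι^* u_i + ∑ ℝ_{≥ 0} |w_i|² (-ι^* u_i)`. -/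
def semistable (α : Module.Dual ℝ K.lie) (β : K.lie →ₗ[ℝ] ℂ) : Set (HSpace N) :=
  {p | muC K p = β ∧ ∃ a b : Fin N → ℝ, (∀ i, 0 ≤ a i) ∧ (∀ i, 0 ≤ b i) ∧
    α = ∑ i, (a i * ‖p.1 i‖ ^ 2) • K.u i + ∑ i, (b i * ‖p.2 i‖ ^ 2) • (-K.u i)}

/-- The (underlying set of the) categorical quotient `μ_ℂ⁻¹(β)^{α-ss} // K_ℂ`: semi-stable points
are identified when the closures of their `K_ℂ`-orbits in `μ_ℂ⁻¹(β)^{α-ss}` intersect. -/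
def GIT (α : Module.Dual ℝ K.lie) (β : K.lie →ₗ[ℝ] ℂ) : Type :=
  Quot fun p q : semistable K α β =>
    (closure (orbitC K p.1) ∩ closure (orbitC K q.1) ∩ semistable K α β).Nonempty

lemma levelSet_subset_semistable (α : Module.Dual ℝ K.lie) (β : K.lie →ₗ[ℝ] ℂ) :
    levelSet K α β ⊆ semistable K α β := by
  rintro p ⟨h1, h2⟩
  refine ⟨h2, fun _ => Real.pi, fun _ => Real.pi, fun _ => Real.pi_pos.le,
    fun _ => Real.pi_pos.le, ?_⟩
  rw [← h1, mu1, ← Finset.sum_add_distrib, Finset.smul_sum]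
  refine Finset.sum_congr rfl fun i _ => ?_
  module

lemma mem_semistable_zero {β : K.lie →ₗ[ℝ] ℂ} {p : HSpace N} (h : muC K p = β) :
    p ∈ semistable K 0 β :=
  ⟨h, 0, 0, fun _ => le_rfl, fun _ => le_rfl, by simp⟩

lemma mem_orbitC_self (p : HSpace N) : p ∈ orbitC K p := ⟨1, one_mem _, actC_one p⟩

lemma act_mem_orbitC {κ : Fin N → Circle} (hκ : κ ∈ K.toSubgroup) (p : HSpace N) :
    act κ p ∈ orbitC K p :=
  ⟨toComplexTorus κ, ⟨κ, hκ, 0, zero_mem _, by rw [expI_zero, mul_one]⟩, rfl⟩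

/-- The natural map `X(α, β) → μ_ℂ⁻¹(β)^{α-ss} // K_ℂ`, induced by
`μ⁻¹(α, β) ⊂ μ_ℂ⁻¹(β)^{α-ss}`. -/
def toGIT (α : Module.Dual ℝ K.lie) (β : K.lie →ₗ[ℝ] ℂ) : X K α β → GIT K α β :=
  Quotient.lift (fun p => Quot.mk _ ⟨p.1, levelSet_subset_semistable K α β p.2⟩) (by
    rintro p q ⟨κ, hκ, h⟩
    refine Quot.sound ⟨q.1, ⟨subset_closure (h ▸ act_mem_orbitC K hκ p.1),
      subset_closure (mem_orbitC_self K q.1)⟩, levelSet_subset_semistable K α β q.2⟩)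

/-- The map `μ_ℂ⁻¹(β)^{α-ss} // K_ℂ → μ_ℂ⁻¹(β) // K_ℂ` induced by the inclusion
`μ_ℂ⁻¹(β)^{α-ss} ⊂ μ_ℂ⁻¹(β) = μ_ℂ⁻¹(β)^{0-ss}`. -/
def gitMap (α : Module.Dual ℝ K.lie) (β : K.lie →ₗ[ℝ] ℂ) : GIT K α β → GIT K 0 β :=
  Quot.lift (fun p => Quot.mk _ ⟨p.1, mem_semistable_zero K p.2.1⟩) (by
    rintro p q ⟨r, hr, hr'⟩
    exact Quot.sound ⟨r, hr, mem_semistable_zero K hr'.1⟩)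

/-! ### The identification of `X(0, β)` with the affine quotient

The facts up to `gitEquiv` show that `toGIT K 0 β` is a bijection, which is what is needed to
regard the map of GIT quotients as a map `X(α, β) → X(0, β)`. -/

/-- The squared Euclidean norm on `ℍ^N`. -/
def nsq (p : HSpace N) : ℝ := ∑ i, (‖p.1 i‖ ^ 2 + ‖p.2 i‖ ^ 2)

lemma continuous_nsq : Continuous (nsq (N := N)) := by unfold nsq; fun_prop

lemma continuous_actC (ζ : Fin N → ℂˣ) : Continuous (actC ζ) := by unfold actC; fun_prop

lemma norm_expI (Y : Fin N → ℝ) (i : Fin N) :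
    ‖(expI Y i : ℂ)‖ = Real.exp (-(2 * Real.pi * Y i)) := by
  simp only [expI, Units.val_mk0, Complex.norm_exp]
  congr 1
  simp

lemma expI_val (Y : Fin N → ℝ) (i : Fin N) :
    (expI Y i : ℂ) = (Real.exp (-(2 * Real.pi * Y i)) : ℝ) := by
  simp only [expI, Units.val_mk0, Complex.ofReal_exp]
  congr 1
  push_cast
  linear_combination (2 * Real.pi * Y i : ℂ) * Complex.I_mul_I

lemma actC_norm_fst (κ : Fin N → Circle) (Y : Fin N → ℝ) (p : HSpace N) (i : Fin N) :
    ‖(actC (toComplexTorus κ * expI Y) p).1 i‖ = ‖p.1 i‖ * Real.exp (-(2 * Real.pi * Y i)) := by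
  simp [actC, norm_toComplexTorus, norm_expI]

lemma actC_norm_snd (κ : Fin N → Circle) (Y : Fin N → ℝ) (p : HSpace N) (i : Fin N) :
    ‖(actC (toComplexTorus κ * expI Y) p).2 i‖ = ‖p.2 i‖ * Real.exp (2 * Real.pi * Y i) := by
  simp [actC, norm_toComplexTorus, norm_expI, Real.exp_neg]

lemma actC_mem_closure {p q : HSpace N} (hq : q ∈ closure (orbitC K p)) {ζ : Fin N → ℂˣ}
    (hζ : ζ ∈ K.complexification) : actC ζ q ∈ closure (orbitC K p) := by
  refine map_mem_closure (continuous_actC ζ) hq ?_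
  rintro _ ⟨η, hη, rfl⟩
  exact ⟨ζ * η, mul_mem hζ hη, actC_mul _ _ _⟩

lemma closure_orbitC_subset {p q : HSpace N} (hq : q ∈ closure (orbitC K p)) :
    closure (orbitC K q) ⊆ closure (orbitC K p) := by
  refine closure_minimal ?_ isClosed_closure
  rintro _ ⟨ζ, hζ, rfl⟩
  exact actC_mem_closure K hq hζ

lemma muC_of_mem_closure {p q : HSpace N} (hq : q ∈ closure (orbitC K p)) :
    muC K q = muC K p := by
  ext Y
  have hc : Continuous fun r : HSpace N => muC K r Y := by
    simp only [muC, LinearMap.smul_apply, LinearMap.sum_apply, LinearMap.smulRight_apply]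
    fun_prop
  have hcl : IsClosed {r : HSpace N | muC K r Y = muC K p Y} := isClosed_eq hc continuous_const
  refine closure_minimal ?_ hcl hq
  rintro _ ⟨ζ, -, rfl⟩
  exact congrArg (fun f => f Y) (muC_actC K ζ p)

lemma mu1_eq_zero_iff (p : HSpace N) :
    mu1 K p = 0 ↔ ∀ Y ∈ K.lie, ∑ i, (‖p.1 i‖ ^ 2 - ‖p.2 i‖ ^ 2) * Y i = 0 := by
  rw [mu1, smul_eq_zero_iff_right Real.pi_ne_zero, LinearMap.ext_iff]
  simp [Subtorus.u]

/-- A point of minimal norm in the closure of a `K_ℂ`-orbit is a zero of `μ₁`. -/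
lemma exists_mu1_zero (p : HSpace N) : ∃ q ∈ closure (orbitC K p), mu1 K q = 0 := by
  have hp : p ∈ closure (orbitC K p) := subset_closure (mem_orbitC_self K p)
  have hbd : Bornology.IsBounded {r : HSpace N | nsq r ≤ nsq p} := by
    refine (Metric.isBounded_closedBall (x := (0 : HSpace N)) (r := √(nsq p))).subset ?_
    intro r hr
    have h1 : ∀ i, ‖r.1 i‖ ^ 2 + ‖r.2 i‖ ^ 2 ≤ nsq p := fun i =>
      (Finset.single_le_sum (f := fun i => ‖r.1 i‖ ^ 2 + ‖r.2 i‖ ^ 2)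
        (fun i _ => by positivity) (Finset.mem_univ i)).trans hr
    rw [mem_closedBall_zero_iff, Prod.norm_def]
    refine max_le ?_ ?_ <;> rw [pi_norm_le_iff_of_nonneg (Real.sqrt_nonneg _)] <;> intro i <;>
      refine Real.le_sqrt_of_sq_le ?_ <;> nlinarith [h1 i, sq_nonneg ‖r.1 i‖, sq_nonneg ‖r.2 i‖]
  have hcpt : IsCompact (closure (orbitC K p) ∩ {r | nsq r ≤ nsq p}) :=
    Metric.isCompact_of_isClosed_isBounded
      (isClosed_closure.inter (isClosed_le continuous_nsq continuous_const))
      (hbd.subset Set.inter_subset_right)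
  obtain ⟨q, hq, hmin⟩ := hcpt.exists_isMinOn ⟨p, hp, le_refl (nsq p)⟩ continuous_nsq.continuousOn
  refine ⟨q, hq.1, (mu1_eq_zero_iff K q).2 fun Y hY => ?_⟩
  have hmin' : ∀ r ∈ closure (orbitC K p), nsq q ≤ nsq r := by
    intro r hr
    by_cases h : nsq r ≤ nsq p
    · exact hmin ⟨hr, h⟩
    · exact (show nsq q ≤ nsq p from hq.2).trans (not_le.1 h).le
  let g : ℝ → ℝ := fun t => ∑ i, (‖q.1 i‖ ^ 2 * Real.exp (t * (-(4 * Real.pi * Y i))) +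
    ‖q.2 i‖ ^ 2 * Real.exp (t * (4 * Real.pi * Y i)))
  have hg : ∀ t, g t = nsq (actC (toComplexTorus 1 * expI (t • Y)) q) := by
    intro t
    refine Finset.sum_congr rfl fun i _ => ?_
    rw [actC_norm_fst, actC_norm_snd, mul_pow, mul_pow, ← Real.exp_nat_mul, ← Real.exp_nat_mul]
    simp only [Pi.smul_apply, smul_eq_mul]
    congr 3 <;> push_cast <;> ring
  have hg0 : g 0 = nsq q := by simp [g, nsq]
  have hloc : IsLocalMin g 0 := Eventually.of_forall fun t => by
    rw [hg0, hg t]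
    exact hmin' _ (actC_mem_closure K hq.1 ⟨1, one_mem _, t • Y, K.lie.smul_mem t hY, rfl⟩)
  have hder : HasDerivAt g (∑ i, (‖q.1 i‖ ^ 2 * (Real.exp (0 * (-(4 * Real.pi * Y i))) *
      (1 * (-(4 * Real.pi * Y i)))) +
      ‖q.2 i‖ ^ 2 * (Real.exp (0 * (4 * Real.pi * Y i)) * (1 * (4 * Real.pi * Y i))))) 0 := by
    refine HasDerivAt.fun_sum fun i _ => ?_
    exact ((((hasDerivAt_id' (0 : ℝ)).mul_const _).exp.const_mul _).add
      (((hasDerivAt_id' (0 : ℝ)).mul_const _).exp.const_mul _))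
  have h0 := hloc.hasDerivAt_eq_zero hder
  have h1 : (-(4 * Real.pi)) * ∑ i, (‖q.1 i‖ ^ 2 - ‖q.2 i‖ ^ 2) * Y i = 0 := by
    rw [← h0, Finset.mul_sum]
    refine Finset.sum_congr rfl fun i _ => ?_
    simp only [zero_mul, Real.exp_zero]
    ring
  exact (mul_eq_zero.1 h1).resolve_left (by simp [Real.pi_ne_zero])

lemma mul_log_le {a x : ℝ} (ha : 0 ≤ a) (hx : 0 ≤ x) (h : a ≠ 0 → x ≠ 0) :
    a * Real.log x - a * Real.log a ≤ x - a := by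
  rcases ha.eq_or_lt with rfl | ha
  · simpa using hx
  · have hx' : 0 < x := lt_of_le_of_ne hx (h ha.ne').symm
    have := Real.log_le_sub_one_of_pos (div_pos hx' ha)
    rw [Real.log_div hx'.ne' ha.ne'] at this
    have h2 := mul_le_mul_of_nonneg_left this ha.le
    have h3 : a * (x / a - 1) = x - a := by field_simp
    linarith

/-- A zero of `μ₁` in the closure of a `K_ℂ`-orbit has minimal norm there. -/
lemma nsq_le_of_mu1_zero {p q r : HSpace N} (hq : q ∈ closure (orbitC K p)) (h : mu1 K q = 0)
    (hr : r ∈ orbitC K p) : nsq q ≤ nsq r := by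
  have hz1 : ∀ i, p.1 i = 0 → q.1 i = 0 := fun i hi => by
    have hcl : IsClosed {s : HSpace N | s.1 i = 0} := isClosed_eq (by fun_prop) continuous_const
    refine closure_minimal ?_ hcl hq
    rintro _ ⟨ζ, -, rfl⟩
    simp [actC, hi]
  have hz2 : ∀ i, p.2 i = 0 → q.2 i = 0 := fun i hi => by
    have hcl : IsClosed {s : HSpace N | s.2 i = 0} := isClosed_eq (by fun_prop) continuous_const
    refine closure_minimal ?_ hcl hq
    rintro _ ⟨ζ, -, rfl⟩
    simp [actC, hi]
  let L : HSpace N → ℝ := fun s => ∑ i, (‖q.1 i‖ ^ 2 * Real.log (‖s.1 i‖ ^ 2) +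
    ‖q.2 i‖ ^ 2 * Real.log (‖s.2 i‖ ^ 2))
  have hconst : ∀ s ∈ orbitC K p, L s = L p := by
    rintro _ ⟨_, ⟨κ, hκ, Y, hY, rfl⟩, rfl⟩
    have hY0 := (mu1_eq_zero_iff K q).1 h Y hY
    have : L (actC (toComplexTorus κ * expI Y) p) - L p =
        (-(4 * Real.pi)) * ∑ i, (‖q.1 i‖ ^ 2 - ‖q.2 i‖ ^ 2) * Y i := by
      simp only [L]
      rw [← Finset.sum_sub_distrib, Finset.mul_sum]
      refine Finset.sum_congr rfl fun i _ => ?_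
      rw [actC_norm_fst, actC_norm_snd]
      have e1 : ‖q.1 i‖ ^ 2 * Real.log ((‖p.1 i‖ * Real.exp (-(2 * Real.pi * Y i))) ^ 2) =
          ‖q.1 i‖ ^ 2 * (Real.log (‖p.1 i‖ ^ 2) - 4 * Real.pi * Y i) := by
        by_cases hp : p.1 i = 0
        · simp [hz1 i hp]
        · have : ‖p.1 i‖ ≠ 0 := norm_ne_zero_iff.2 hp
          rw [Real.log_pow, Real.log_mul this (Real.exp_ne_zero _), Real.log_exp, Real.log_pow]
          push_cast
          ring
      have e2 : ‖q.2 i‖ ^ 2 * Real.log ((‖p.2 i‖ * Real.exp (2 * Real.pi * Y i)) ^ 2) =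
          ‖q.2 i‖ ^ 2 * (Real.log (‖p.2 i‖ ^ 2) + 4 * Real.pi * Y i) := by
        by_cases hp : p.2 i = 0
        · simp [hz2 i hp]
        · have : ‖p.2 i‖ ≠ 0 := norm_ne_zero_iff.2 hp
          rw [Real.log_pow, Real.log_mul this (Real.exp_ne_zero _), Real.log_exp, Real.log_pow]
          push_cast
          ring
      rw [e1, e2]
      ring
    rw [hY0, mul_zero] at this
    linarith
  have hcont : ContinuousAt L q := by
    refine tendsto_finsetSum _ fun i _ => Tendsto.add ?_ ?_
    · by_cases hi : q.1 i = 0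
      · simp [hi]
      · exact Tendsto.const_mul _ (ContinuousAt.log (by fun_prop) (by simpa using hi))
    · by_cases hi : q.2 i = 0
      · simp [hi]
      · exact Tendsto.const_mul _ (ContinuousAt.log (by fun_prop) (by simpa using hi))
  have hLq : L q = L p := by
    have : (𝓝[orbitC K p] q).NeBot := mem_closure_iff_nhdsWithin_neBot.1 hq
    refine tendsto_nhds_unique (hcont.mono_left nhdsWithin_le_nhds : Tendsto L (𝓝[orbitC K p] q) _)
      (tendsto_const_nhds.congr' ?_)
    filter_upwards [self_mem_nhdsWithin] with s hs using (hconst s hs).symm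
  have hsum : L r - L q ≤ nsq r - nsq q := by
    simp only [L, nsq]
    rw [← Finset.sum_sub_distrib, ← Finset.sum_sub_distrib]
    refine Finset.sum_le_sum fun i _ => ?_
    have hr1 : q.1 i ≠ 0 → r.1 i ≠ 0 := by
      obtain ⟨ζ, -, rfl⟩ := hr
      intro hqi
      simp [actC, mt (hz1 i) hqi]
    have hr2 : q.2 i ≠ 0 → r.2 i ≠ 0 := by
      obtain ⟨ζ, -, rfl⟩ := hr
      intro hqi
      simp [actC, mt (hz2 i) hqi]
    have l1 := mul_log_le (a := ‖q.1 i‖ ^ 2) (x := ‖r.1 i‖ ^ 2) (by positivity) (by positivity)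
      (by simpa using hr1)
    have l2 := mul_log_le (a := ‖q.2 i‖ ^ 2) (x := ‖r.2 i‖ ^ 2) (by positivity) (by positivity)
      (by simpa using hr2)
    linarith
  rw [hconst r hr, hLq] at hsum
  linarith

lemma compl_eq_of_norm {a b c : ℂ} (ha : a * star c = ‖a‖ * ‖c‖) (hb : b * star c = ‖b‖ * ‖c‖)
    (hab : ‖a‖ = ‖b‖) (h0 : c = 0 → a = 0) : a = b := by
  by_cases hc : c = 0
  · have := h0 hc
    rw [this, norm_zero] at hab
    rw [this, norm_eq_zero.1 hab.symm]
  · have : star c ≠ 0 := by simpa using hc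
    exact mul_right_cancel₀ this (by rw [ha, hb, hab])

/-- Some `K`-translate of a point in the closure of a `K_ℂ`-orbit has the phases of the base
point. -/
lemma exists_phase {p q : HSpace N} (hq : q ∈ closure (orbitC K p)) : ∃ κ ∈ K.toSubgroup,
    (∀ i, (act κ q).1 i * star (p.1 i) = ‖(act κ q).1 i‖ * ‖p.1 i‖) ∧
    (∀ i, (act κ q).2 i * star (p.2 i) = ‖(act κ q).2 i‖ * ‖p.2 i‖) ∧
    (∀ i, p.1 i = 0 → (act κ q).1 i = 0) ∧ (∀ i, p.2 i = 0 → (act κ q).2 i = 0) := by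
  let D : Set (HSpace N) := {s |
    (∀ i, s.1 i * star (p.1 i) = ‖s.1 i‖ * ‖p.1 i‖) ∧
    (∀ i, s.2 i * star (p.2 i) = ‖s.2 i‖ * ‖p.2 i‖) ∧
    (∀ i, p.1 i = 0 → s.1 i = 0) ∧ (∀ i, p.2 i = 0 → s.2 i = 0)}
  have hD : IsClosed D := by
    simp only [D, Set.ofPred_and, Set.ofPred_forall]
    refine IsClosed.inter ?_ (IsClosed.inter ?_ (IsClosed.inter ?_ ?_))
    · exact isClosed_iInter fun i => isClosed_eq (by fun_prop) (by fun_prop)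
    · exact isClosed_iInter fun i => isClosed_eq (by fun_prop) (by fun_prop)
    · exact isClosed_iInter fun i => isClosed_iInter fun _ => isClosed_eq (by fun_prop) (by fun_prop)
    · exact isClosed_iInter fun i => isClosed_iInter fun _ => isClosed_eq (by fun_prop) (by fun_prop)
  let S : Set ((Fin N → Circle) × HSpace N) := {x | x.1 ∈ K.toSubgroup ∧ act x.1 x.2 ∈ D}
  have hact : Continuous fun x : (Fin N → Circle) × HSpace N => act x.1 x.2 := by
    have e : (fun x : (Fin N → Circle) × HSpace N => act x.1 x.2) = fun x =>
        (fun i => x.2.1 i * ((x.1 i : Circle) : ℂ),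
          fun i => x.2.2 i * (((x.1 i)⁻¹ : Circle) : ℂ)) := by
      funext x
      refine Prod.ext ?_ ?_ <;> funext i <;> simp [act, actC, toComplexTorus]
    rw [e]
    fun_prop
  have hS : IsClosed S :=
    (K.isClosed'.preimage continuous_fst).inter (hD.preimage hact)
  have hcl : IsClosed (Prod.snd '' S) := isClosedMap_snd_of_compactSpace _ hS
  have hsub : orbitC K p ⊆ Prod.snd '' S := by
    rintro _ ⟨_, ⟨κ, hκ, Y, hY, rfl⟩, rfl⟩
    refine ⟨(κ⁻¹, _), ⟨inv_mem hκ, ?_⟩, rfl⟩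
    have e : act κ⁻¹ (actC (toComplexTorus κ * expI Y) p) = actC (expI Y) p := by
      rw [act, ← actC_mul, ← mul_assoc, ← map_mul, inv_mul_cancel, map_one, one_mul]
    change act κ⁻¹ (actC (toComplexTorus κ * expI Y) p) ∈ D
    rw [e]
    have key : ∀ (c : ℂ) (t : ℝ), 0 ≤ t → c * (t : ℂ) * star c = ‖c * (t : ℂ)‖ * ‖c‖ := by
      intro c t ht
      rw [norm_mul, Complex.norm_real, Real.norm_of_nonneg ht]
      have : c * star c = (‖c‖ : ℂ) ^ 2 := by
        simpa using Complex.mul_conj' c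
      push_cast
      linear_combination (t : ℂ) * this
    refine ⟨fun i => ?_, fun i => ?_, fun i hi => ?_, fun i hi => ?_⟩
    · simp only [actC, expI_val]
      exact key _ _ (Real.exp_pos _).le
    · simp only [actC, Units.val_inv_eq_inv_val, expI_val, ← Complex.ofReal_inv]
      exact key _ _ (inv_nonneg.2 (Real.exp_pos _).le)
    · simp [actC, hi]
    · simp [actC, hi]
  obtain ⟨⟨κ, r⟩, ⟨hκ, hd⟩, rfl⟩ := closure_minimal hsub hcl hq
  exact ⟨κ, hκ, hd⟩

lemma norm_act_fst (κ : Fin N → Circle) (p : HSpace N) (i : Fin N) :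
    ‖(act κ p).1 i‖ = ‖p.1 i‖ := by
  simp [act, actC, norm_toComplexTorus]

lemma norm_act_snd (κ : Fin N → Circle) (p : HSpace N) (i : Fin N) :
    ‖(act κ p).2 i‖ = ‖p.2 i‖ := by
  simp [act, actC, norm_toComplexTorus]

/-- The zeros of `μ₁` in the closure of a `K_ℂ`-orbit form at most one `K`-orbit. -/
lemma unique_mu1_zero {p q q' : HSpace N} (hq : q ∈ closure (orbitC K p))
    (hq' : q' ∈ closure (orbitC K p)) (h : mu1 K q = 0) (h' : mu1 K q' = 0) :
    ∃ κ ∈ K.toSubgroup, act κ q = q' := by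
  have hle : ∀ {a b : HSpace N}, a ∈ closure (orbitC K p) → b ∈ closure (orbitC K p) →
      mu1 K a = 0 → nsq a ≤ nsq b := by
    intro a b ha hb h0
    have hcl : IsClosed {s : HSpace N | nsq a ≤ nsq s} :=
      isClosed_le continuous_const continuous_nsq
    exact closure_minimal (fun s hs => nsq_le_of_mu1_zero K ha h0 hs) hcl hb
  have heq : nsq q = nsq q' := le_antisymm (hle hq hq' h) (hle hq' hq h')
  have hmid : nsq q ≤ ∑ i, (‖q.1 i‖ * ‖q'.1 i‖ + ‖q.2 i‖ * ‖q'.2 i‖) := by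
    let C : Set (HSpace N × HSpace N) :=
      {x | nsq q ≤ ∑ i, (‖x.1.1 i‖ * ‖x.2.1 i‖ + ‖x.1.2 i‖ * ‖x.2.2 i‖)}
    have hC : IsClosed C := isClosed_le continuous_const (by fun_prop)
    have hsub : orbitC K p ×ˢ orbitC K p ⊆ C := by
      rintro ⟨_, _⟩ ⟨⟨_, ⟨κ, hκ, Y, hY, rfl⟩, rfl⟩, ⟨_, ⟨κ', hκ', Y', hY', rfl⟩, rfl⟩⟩
      have hs := nsq_le_of_mu1_zero K hq h (r := actC (toComplexTorus 1 *
        expI ((1 / 2 : ℝ) • (Y + Y'))) p) ⟨_, ⟨1, one_mem _, _,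
          K.lie.smul_mem _ (add_mem hY hY'), rfl⟩, rfl⟩
      refine hs.trans (le_of_eq (Finset.sum_congr rfl fun i _ => ?_))
      simp only [actC_norm_fst, actC_norm_snd, Pi.smul_apply, Pi.add_apply, smul_eq_mul]
      have e1 : ∀ a b : ℝ, Real.exp a * Real.exp b = Real.exp ((a + b) / 2) ^ 2 := fun a b => by
        rw [← Real.exp_add, ← Real.exp_nat_mul]; congr 1; push_cast; ring
      rw [mul_mul_mul_comm ‖p.1 i‖, mul_mul_mul_comm ‖p.2 i‖, e1, e1, mul_pow, mul_pow, ← sq, ← sq]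
      congr 4 <;> ring
    have : (q, q') ∈ closure (orbitC K p ×ˢ orbitC K p) := by
      rw [closure_prod_eq]; exact ⟨hq, hq'⟩
    exact closure_minimal hsub hC this
  have hsq : ∑ i, ((‖q.1 i‖ - ‖q'.1 i‖) ^ 2 + (‖q.2 i‖ - ‖q'.2 i‖) ^ 2) ≤ 0 := by
    have e : ∑ i, ((‖q.1 i‖ - ‖q'.1 i‖) ^ 2 + (‖q.2 i‖ - ‖q'.2 i‖) ^ 2) =
        nsq q + nsq q' - 2 * ∑ i, (‖q.1 i‖ * ‖q'.1 i‖ + ‖q.2 i‖ * ‖q'.2 i‖) := by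
      simp only [nsq]
      rw [← Finset.sum_add_distrib, Finset.mul_sum, ← Finset.sum_sub_distrib]
      exact Finset.sum_congr rfl fun i _ => by ring
    rw [e]
    linarith
  have hz := (Finset.sum_eq_zero_iff_of_nonneg (fun i _ => by positivity)).1
    (le_antisymm hsq (Finset.sum_nonneg fun i _ => by positivity))
  have hn1 : ∀ i, ‖q.1 i‖ = ‖q'.1 i‖ := fun i => by
    have := hz i (Finset.mem_univ i)
    nlinarith [sq_nonneg (‖q.1 i‖ - ‖q'.1 i‖), sq_nonneg (‖q.2 i‖ - ‖q'.2 i‖)]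
  have hn2 : ∀ i, ‖q.2 i‖ = ‖q'.2 i‖ := fun i => by
    have := hz i (Finset.mem_univ i)
    nlinarith [sq_nonneg (‖q.1 i‖ - ‖q'.1 i‖), sq_nonneg (‖q.2 i‖ - ‖q'.2 i‖)]
  obtain ⟨κ, hκ, a1, a2, a3, a4⟩ := exists_phase K hq
  obtain ⟨κ', hκ', b1, b2, b3, b4⟩ := exists_phase K hq'
  have e : act κ q = act κ' q' := by
    refine Prod.ext ?_ ?_ <;> funext i
    · exact compl_eq_of_norm (a1 i) (b1 i) (by rw [norm_act_fst, norm_act_fst, hn1]) (a3 i)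
    · exact compl_eq_of_norm (a2 i) (b2 i) (by rw [norm_act_snd, norm_act_snd, hn2]) (a4 i)
  exact ⟨κ'⁻¹ * κ, mul_mem (inv_mem hκ') hκ, by
    rw [act_mul, e, ← act_mul, inv_mul_cancel, act_one]⟩

lemma toGIT_zero_bijective (β : K.lie →ₗ[ℝ] ℂ) : Function.Bijective (toGIT K 0 β) := by
  choose f hf hf0 using exists_mu1_zero K
  have hfl : ∀ p, muC K p = β → f p ∈ levelSet K 0 β := fun p hp =>
    ⟨hf0 p, (muC_of_mem_closure K (hf p)).trans hp⟩
  let Φ : GIT K 0 β → X K 0 β := Quot.lift (fun p => X.mk K ⟨f p.1, hfl p.1 p.2.1⟩) (by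
    rintro p q ⟨r, ⟨hrp, hrq⟩, hr⟩
    have h1 : X.mk K ⟨f p.1, hfl p.1 p.2.1⟩ = X.mk K ⟨f r, hfl r hr.1⟩ := Quotient.sound
      (unique_mu1_zero K (hf p.1) (closure_orbitC_subset K hrp (hf r)) (hf0 _) (hf0 _))
    have h2 : X.mk K ⟨f q.1, hfl q.1 q.2.1⟩ = X.mk K ⟨f r, hfl r hr.1⟩ := Quotient.sound
      (unique_mu1_zero K (hf q.1) (closure_orbitC_subset K hrq (hf r)) (hf0 _) (hf0 _))
    exact h1.trans h2.symm)
  refine Function.bijective_iff_has_inverse.2 ⟨Φ, fun x => ?_, fun y => ?_⟩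
  · induction x using Quotient.inductionOn with | _ p => ?_
    exact Quotient.sound (unique_mu1_zero K (hf p.1) (subset_closure (mem_orbitC_self K p.1))
      (hf0 _) p.2.1)
  · induction y using Quot.inductionOn with | _ p => ?_
    exact Quot.sound ⟨f p.1, ⟨subset_closure (mem_orbitC_self K _), hf p.1⟩,
      mem_semistable_zero K (hfl p.1 p.2.1).2⟩

/-- The identification of `X(0, β)` with the affine quotient `μ_ℂ⁻¹(β) // K_ℂ`. -/
def gitEquiv (β : K.lie →ₗ[ℝ] ℂ) : X K 0 β ≃ GIT K 0 β :=
  Equiv.ofBijective (toGIT K 0 β) (toGIT_zero_bijective K β)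

/-- The natural morphism `π₁ : X(α, β) → X(0, β)`: the map of GIT quotients induced by the
inclusion `μ_ℂ⁻¹(β)^{α-ss} ⊂ μ_ℂ⁻¹(β)`. -/
def naturalMorphism (α : Module.Dual ℝ K.lie) (β : K.lie →ₗ[ℝ] ℂ) (x : X K α β) : X K 0 β :=
  (gitEquiv K β).symm (gitMap K α β (toGIT K α β x))

/-! ### Toric subvarieties -/

/-- `V_ε`: the points with `w_i = 0` if `ε(i) = 1`, and `z_i = 0` if `ε(i) = -1`. -/
def V (ε : Fin N → ℤˣ) : Set (HSpace N) :=
  {p | ∀ i, (ε i = 1 → p.2 i = 0) ∧ (ε i = -1 → p.1 i = 0)}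

/-- `M_ε(α) = (V_ε ∩ μ₁⁻¹(α)) / K ⊂ X(α, 0)`; note that `μ_ℂ = 0` on `V_ε`. -/
def M (α : Module.Dual ℝ K.lie) (ε : Fin N → ℤˣ) : Set (X K α 0) :=
  X.mk K '' {p | p.1 ∈ V ε}

/-- `Θ_cpt(α)`: the set of all `ε` such that `M_ε(α)` is compact. -/
def compactSigns (α : Module.Dual ℝ K.lie) : Set (Fin N → ℤˣ) := {ε | IsCompact (M K α ε)}

end

/-- `A` is a `G`-equivariant (strong) deformation retract of the `G`-space `Y`: there is a
`G`-equivariant homotopy, fixing `A` pointwise, from the identity of `Y` to a map into `A`. -/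
def IsEquivariantDeformationRetract (G : Type*) {Y : Type*} [SMul G Y] [TopologicalSpace Y]
    (A : Set Y) : Prop :=
  ∃ H : C(unitInterval × Y, Y),
    (∀ y, H (0, y) = y) ∧ (∀ y, H (1, y) ∈ A) ∧ (∀ t, ∀ a ∈ A, H (t, a) = a) ∧
      ∀ t (g : G) y, H (t, g • y) = g • H (t, y)

end ToricHK

/-!
The fibre of `π₁` over `[0, 0]` consists of the classes of the points of the null cone: those that
some one-parameter subgroup of `K_ℂ`, generated by `Y ∈ k`, moves to `0`.

Shrinking the coordinates of `p = (z, w)`, one can give the level `‖z i‖² - ‖w i‖²` any value in a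
polytope without changing `μ₁`. The point `x` of least norm of this polytope depends continuously on
`p`. By minimality and Gordan's alternative, some `Y ∈ k` has the sign of `x i` wherever `x i ≠ 0`,
so a point of level `x` with all `z i * w i = 0` lies in the null cone; over a point of the null
cone, conversely, the polytope is a single point. The retraction moves the level linearly to `x` and
multiplies all the products `z i * w i` by `√(1 - t)`. It commutes with the torus, because it only
rescales coordinates by factors that depend on their absolute values.

If no `ι^* u i` vanishes, then `Y` can be perturbed to have no vanishing coordinate, so the null
cone is the union of the `V ε` over the sign vectors `ε` of such elements of `k`. For these `ε`,
pairing `μ₁` with `Y` bounds all the coordinates on `M ε`. For any other `ε`, Gordan's alternative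
gives a relation between the `ι^* u i` with signs from `ε`, along which a nonempty `M ε` is
unbounded.
-/

namespace ToricHK

/-! ### Gordan's alternative -/

section Gordan

variable {ι E F : Type*} [Fintype ι] [AddCommGroup E] [Module ℝ E] [AddCommGroup F] [Module ℝ F]

/-- The linear relations between the members of a finite family of vectors. -/
def relations (u : ι → F) : Submodule ℝ (ι → ℝ) := LinearMap.ker (Fintype.linearCombination ℝ u)

lemma mem_relations {u : ι → F} {l : ι → ℝ} : l ∈ relations u ↔ ∑ i, l i • u i = 0 := by
  rw [relations, LinearMap.mem_ker, Fintype.linearCombination_apply]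

lemma isClosed_relations (u : ι → F) : IsClosed (relations u : Set (ι → ℝ)) :=
  Submodule.closed_of_finiteDimensional _

lemma map_eq_zero_of_forall_le {f : Module.Dual ℝ E} {S : Submodule ℝ E} {c : ℝ}
    (h : ∀ y ∈ S, c ≤ f y) {y : E} (hy : y ∈ S) : f y = 0 := by
  by_contra hne
  have := h _ (S.smul_mem ((c - 1) / f y) hy)
  rw [map_smul, smul_eq_mul, div_mul_cancel₀ _ hne] at this
  linarith

-- Separate the positive orthant from the range of `Y ↦ (f i Y)_i`.
theorem exists_forall_pos_or_exists_stdSimplex_sum_eq_zero (f : ι → Module.Dual ℝ E) :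
    (∃ Y, ∀ i, 0 < f i Y) ∨ ∃ c ∈ stdSimplex ℝ ι, ∑ i, c i • f i = 0 := by
  classical
  refine or_iff_not_imp_left.2 fun hf => ?_
  let orthant : Set (ι → ℝ) := Set.univ.pi fun _ => Set.Ioi 0
  have hdisj : Disjoint orthant (LinearMap.range (LinearMap.pi f) : Set (ι → ℝ)) := by
    rw [Set.disjoint_left]
    rintro _ hpos ⟨Y, rfl⟩
    exact hf ⟨Y, fun i => hpos i trivial⟩
  obtain ⟨g, c, horthant, hrange⟩ := geometric_hahn_banach_open
    (convex_pi fun _ _ => convex_Ioi 0) (isOpen_set_pi Set.finite_univ fun _ _ => isOpen_Ioi)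
    (Submodule.convex _) hdisj
  have hc : c ≤ 0 := by simpa only [map_zero] using hrange 0 (zero_mem _)
  have hg_range (Y : E) : g (fun i => f i Y) = 0 :=
    map_eq_zero_of_forall_le (f := g.toLinearMap) hrange ⟨Y, rfl⟩
  have hg_one : g 1 < 0 := (horthant 1 fun _ _ => zero_lt_one (α := ℝ)).trans_le hc
  have hg_nonpos {y : ι → ℝ} (hy : 0 ≤ y) : g y ≤ 0 := by
    have hy' : y ∈ closure orthant := by
      rw [closure_pi_set]
      exact fun i _ => by rw [closure_Ioi]; exact hy i
    exact closure_minimal (fun z hz => ((horthant z hz).trans_le hc).le)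
      (isClosed_le g.continuous continuous_const) hy'
  have hg_apply (y : ι → ℝ) : g y = ∑ i, y i * g (Pi.single i 1) := by
    conv_lhs => rw [pi_eq_sum_univ' y]
    simp only [map_sum, map_smul, smul_eq_mul]
  refine ⟨fun i => g (Pi.single i 1) / g 1, ⟨fun i => ?_, ?_⟩, LinearMap.ext fun Y => ?_⟩
  · exact div_nonneg_of_nonpos (hg_nonpos (Pi.single_nonneg.2 zero_le_one)) hg_one.le
  · rw [← Finset.sum_div, div_eq_one_iff_eq hg_one.ne, hg_apply 1]
    simp only [Pi.one_apply, one_mul]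
  · have := hg_range Y
    rw [hg_apply] at this
    simp only [LinearMap.sum_apply, LinearMap.smul_apply, smul_eq_mul, LinearMap.zero_apply,
      div_mul_eq_mul_div, ← Finset.sum_div, mul_comm (g _), this, zero_div]

theorem exists_forall_pos_mul_or_exists_mul_mem_relations (s : ι → ℝ) (u : ι → Module.Dual ℝ E) :
    (∃ Y, ∀ i, s i ≠ 0 → 0 < s i * u i Y) ∨
      ∃ θ : ι → ℝ, (∀ i, θ i ∈ Set.Icc 0 1) ∧ θ * s ≠ 0 ∧ θ * s ∈ relations u := by
  classical
  rcases exists_forall_pos_or_exists_stdSimplex_sum_eq_zero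
    fun i : {i // s i ≠ 0} => s i • u i with ⟨Y, hY⟩ | ⟨c, hc, hsum⟩
  · exact .inl ⟨Y, fun i hi => hY ⟨i, hi⟩⟩
  let θ : ι → ℝ := fun i => if h : s i ≠ 0 then c ⟨i, h⟩ else 0
  have hθ (i : {i // s i ≠ 0}) : θ i = c i := dif_pos i.2
  refine .inr ⟨θ, fun i => ?_, fun h0 => ?_, ?_⟩
  · by_cases h : s i ≠ 0
    · simpa only [θ, dif_pos h] using mem_Icc_of_mem_stdSimplex hc ⟨i, h⟩
    · simp only [θ, dif_neg h, Set.left_mem_Icc, zero_le_one]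
  · have hc0 (i) : c i = 0 := by
      rw [← hθ]
      exact (mul_eq_zero.1 (congrFun h0 i)).resolve_right i.2
    simpa only [hc0, Finset.sum_const_zero, zero_ne_one] using hc.2
  · rw [mem_relations, ← hsum]
    refine (Fintype.sum_of_injective _ Subtype.val_injective _ _ (fun i hi => ?_) fun i => ?_).symm
    · have : s i = 0 := by simpa using hi
      simp only [Pi.mul_apply, this, mul_zero, zero_smul]
    · rw [Pi.mul_apply, hθ, smul_smul]

end Gordan

/-! ### Continuity of minimizers -/

theorem continuous_of_forall_lt_of_lowerHemicontinuous {X Y β : Type*} [TopologicalSpace X]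
    [TopologicalSpace Y] [LinearOrder β] [TopologicalSpace β] [OrderTopology β]
    {S : X → Set Y} {F : Y → β} {m : X → Y} (hF : Continuous F) (hS : LowerHemicontinuous S)
    (hgraph : IsClosed {q : X × Y | q.2 ∈ S q.1})
    (hcompact : ∀ x, ∃ C, IsCompact C ∧ ∀ᶠ x' in 𝓝 x, S x' ⊆ C) (hm : ∀ x, m x ∈ S x)
    (hmin : ∀ x, ∀ y ∈ S x, y ≠ m x → F (m x) < F y) : Continuous m := by
  rw [continuous_iff_ultrafilter]
  intro x 𝒰 (h𝒰 : Tendsto id 𝒰 (𝓝 x))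
  obtain ⟨C, hC, hSC⟩ := hcompact x
  have hmC : ∀ᶠ x' in 𝒰, m x' ∈ C := (h𝒰.eventually hSC).mono fun x' h => h (hm x')
  obtain ⟨y, -, hy⟩ := hC.ultrafilter_le_nhds (𝒰.map m) (le_principal_iff.2 hmC)
  change Tendsto m 𝒰 (𝓝 y) at hy
  have hyS : y ∈ S x := hgraph.mem_of_tendsto (Tendsto.prodMk_nhds h𝒰 hy)
    (Eventually.of_forall hm)
  suffices y = m x by rwa [← this]
  by_contra hne
  obtain ⟨U, W, hU, hW, hxU, hyW, hUW⟩ := order_separated (hmin x y hyS hne)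
  have hmW : ∀ᶠ x' in 𝒰, F (m x') ∈ W := ((hF.tendsto y).comp hy).eventually (hW.mem_nhds hyW)
  have hSU : ∀ᶠ x' in 𝒰, (S x' ∩ F ⁻¹' U).Nonempty :=
    h𝒰.eventually (lowerHemicontinuousAt_iff.1 (hS x) _ (hU.preimage hF) ⟨m x, hm x, hxU⟩)
  obtain ⟨x', hx'W, z, hzS, hzU⟩ := (hmW.and hSU).exists
  have hlt : F z < F (m x') := hUW _ hzU _ hx'W
  exact (hmin x' z hzS fun h => hlt.ne (congrArg F h)).asymm hlt

/-! ### Least-norm levels -/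

section LevelPolytope

variable {ι : Type*}

/-- The levels `x` congruent to `a - b` modulo `R` with `-b ≤ x ≤ a`. For `a i = ‖z i‖ ^ 2` and
`b i = ‖w i‖ ^ 2`, they are the values of `‖z i‖ ^ 2 - ‖w i‖ ^ 2` that can be reached by shrinking
coordinates while keeping the class modulo `R`, hence the real moment map. -/
def levelPolytope (R : Submodule ℝ (ι → ℝ)) (a b : ι → ℝ) : Set (ι → ℝ) :=
  {x | x - (a - b) ∈ R} ∩ Set.Icc (-b) a

variable {R : Submodule ℝ (ι → ℝ)} {a b : ι → ℝ}

lemma convex_levelPolytope : Convex ℝ (levelPolytope R a b) := by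
  refine Convex.inter ?_ (convex_Icc _ _)
  exact R.convex.affine_preimage (AffineMap.id ℝ (ι → ℝ) - AffineMap.const ℝ _ (a - b))

lemma isCompact_levelPolytope (hR : IsClosed (R : Set (ι → ℝ))) :
    IsCompact (levelPolytope R a b) :=
  isCompact_Icc.inter_left (hR.preimage (continuous_id.sub continuous_const))

lemma sub_add_mem_levelPolytope_iff {l : ι → ℝ} :
    a - b + l ∈ levelPolytope R a b ↔ l ∈ R ∧ -l ≤ a ∧ l ≤ b := by
  refine and_congr (by rw [Set.mem_ofPred_eq, add_sub_cancel_left])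
    (and_congr (forall_congr' fun i => ?_) (forall_congr' fun i => ?_)) <;>
  · simp only [Pi.neg_apply, Pi.add_apply, Pi.sub_apply]
    constructor <;> intro h <;> linarith

lemma sub_mem_levelPolytope (ha : 0 ≤ a) (hb : 0 ≤ b) : a - b ∈ levelPolytope R a b := by
  simpa [ha, hb, zero_mem] using sub_add_mem_levelPolytope_iff (R := R) (a := a) (b := b) (l := 0)

lemma eventually_smul_le [Finite ι] {X : Type*} [TopologicalSpace X] {a : X → ι → ℝ}
    (ha : Continuous a) (ha₀ : ∀ p, 0 ≤ a p) {p : X} {l : ι → ℝ} (hl : l ≤ a p) {c : ℝ}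
    (hc₀ : 0 ≤ c) (hc₁ : c < 1) : ∀ᶠ p' in 𝓝 p, c • l ≤ a p' := by
  refine eventually_all.2 fun i => ?_
  rcases le_or_gt (l i) 0 with hi | hi
  · exact Eventually.of_forall fun p' => (mul_nonpos_of_nonneg_of_nonpos hc₀ hi).trans (ha₀ p' i)
  · have hlt : c * l i < a p i := (mul_lt_of_lt_one_left hi hc₁).trans_le (hl i)
    exact ((continuous_pi_iff.1 ha i).tendsto p).eventually_const_le hlt

-- A point of the polytope is the limit, as `c → 1`, of points whose relation `c • l` satisfies
-- the inequalities with slack, so that they persist under a perturbation of `a` and `b`.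
lemma lowerHemicontinuous_levelPolytope [Finite ι] (R : Submodule ℝ (ι → ℝ)) {X : Type*}
    [TopologicalSpace X] {a b : X → ι → ℝ} (ha : Continuous a) (hb : Continuous b)
    (ha₀ : ∀ p, 0 ≤ a p) (hb₀ : ∀ p, 0 ≤ b p) :
    LowerHemicontinuous fun p => levelPolytope R (a p) (b p) := by
  refine fun p => lowerHemicontinuousAt_iff.2 ?_
  rintro U hU ⟨x, hx, hxU⟩
  obtain ⟨l, rfl⟩ : ∃ l, x = a p - b p + l := ⟨x - (a p - b p), (add_sub_cancel _ _).symm⟩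
  obtain ⟨hl, hla, hlb⟩ := sub_add_mem_levelPolytope_iff.1 hx
  have hnear : ∀ᶠ c : ℝ in 𝓝[<] 1, a p - b p + c • l ∈ U := by
    have hcont : Continuous fun c : ℝ => a p - b p + c • l := by fun_prop
    refine (hcont.tendsto 1).mono_left nhdsWithin_le_nhds (hU.mem_nhds ?_)
    rwa [one_smul]
  obtain ⟨c, hcU, hc₀, hc₁⟩ := (hnear.and (Ioo_mem_nhdsLT zero_lt_one)).exists
  filter_upwards [eventually_smul_le ha ha₀ hla hc₀.le hc₁,
    eventually_smul_le hb hb₀ hlb hc₀.le hc₁,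
    (by fun_prop : Continuous fun p' => a p' - b p' + c • l).tendsto p (hU.mem_nhds hcU)]
    with p' ha' hb' hU'
  exact ⟨_, sub_add_mem_levelPolytope_iff.2 ⟨R.smul_mem c hl, by rwa [← smul_neg], hb'⟩, hU'⟩

variable [Fintype ι]

lemma dotProduct_self_lt_of_isMinOn {S : Set (ι → ℝ)} (hS : Convex ℝ S) {m y : ι → ℝ}
    (hm : m ∈ S) (hmin : IsMinOn (fun x => x ⬝ᵥ x) S m) (hy : y ∈ S) (hne : y ≠ m) :
    m ⬝ᵥ m < y ⬝ᵥ y := by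
  have hmid := isMinOn_iff.1 hmin _ (hS.midpoint_mem hm hy)
  have hpos : 0 < (y - m) ⬝ᵥ (y - m) :=
    (dotProduct_star_self_nonneg _).lt_of_ne' (dotProduct_self_eq_zero.not.2 (sub_ne_zero.2 hne))
  simp only [midpoint_eq_smul_add, smul_dotProduct, dotProduct_smul, add_dotProduct,
    dotProduct_add, sub_dotProduct, dotProduct_sub, smul_eq_mul, invOf_eq_inv,
    dotProduct_comm y m] at hmid hpos
  linarith

lemma dotProduct_self_mono {x y : ι → ℝ} (h : ∀ i, |x i| ≤ |y i|) : x ⬝ᵥ x ≤ y ⬝ᵥ y :=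
  Finset.sum_le_sum fun i _ => abs_le_iff_mul_self_le.1 (h i)

/-- The point of `levelPolytope R a b` closest to the origin; a junk value if there is none. -/
noncomputable def leastNormLevel (R : Submodule ℝ (ι → ℝ)) (a b : ι → ℝ) : ι → ℝ :=
  Classical.epsilon fun x => x ∈ levelPolytope R a b ∧
    IsMinOn (fun x => x ⬝ᵥ x) (levelPolytope R a b) x

section Spec

variable (hR : IsClosed (R : Set (ι → ℝ))) (ha : 0 ≤ a) (hb : 0 ≤ b)
include hR ha hb

lemma leastNormLevel_spec : leastNormLevel R a b ∈ levelPolytope R a b ∧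
    IsMinOn (fun x => x ⬝ᵥ x) (levelPolytope R a b) (leastNormLevel R a b) :=
  Classical.epsilon_spec ((isCompact_levelPolytope hR).exists_isMinOn
    ⟨_, sub_mem_levelPolytope ha hb⟩ (by fun_prop))

lemma leastNormLevel_dotProduct_self_lt {y : ι → ℝ} (hy : y ∈ levelPolytope R a b)
    (hne : y ≠ leastNormLevel R a b) :
    leastNormLevel R a b ⬝ᵥ leastNormLevel R a b < y ⬝ᵥ y :=
  dotProduct_self_lt_of_isMinOn convex_levelPolytope (leastNormLevel_spec hR ha hb).1
    (leastNormLevel_spec hR ha hb).2 hy hne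

end Spec

theorem continuous_leastNormLevel (hR : IsClosed (R : Set (ι → ℝ))) {X : Type*}
    [TopologicalSpace X] {a b : X → ι → ℝ} (ha : Continuous a) (hb : Continuous b)
    (ha₀ : ∀ p, 0 ≤ a p) (hb₀ : ∀ p, 0 ≤ b p) :
    Continuous fun p => leastNormLevel R (a p) (b p) := by
  refine continuous_of_forall_lt_of_lowerHemicontinuous (F := fun x => x ⬝ᵥ x) (by fun_prop)
    (lowerHemicontinuous_levelPolytope R ha hb ha₀ hb₀) ?_ (fun p => ?_)
    (fun p => (leastNormLevel_spec hR (ha₀ p) (hb₀ p)).1)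
    (fun p y => leastNormLevel_dotProduct_self_lt hR (ha₀ p) (hb₀ p))
  · refine (hR.preimage (f := fun q : X × (ι → ℝ) => q.2 - (a q.1 - b q.1)) (by fun_prop)).inter
      ((isClosed_le (f := fun q : X × (ι → ℝ) => -b q.1) (by fun_prop) continuous_snd).inter
        (isClosed_le continuous_snd (by fun_prop)))
  · refine ⟨Set.Icc (-(b p + 1)) (a p + 1), isCompact_Icc, ?_⟩
    have hnear {f : X → ι → ℝ} (hf : Continuous f) : ∀ᶠ p' in 𝓝 p, f p' ≤ f p + 1 :=
      eventually_all.2 fun i =>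
        ((continuous_pi_iff.1 hf i).tendsto p).eventually_le_const (lt_add_one (f p i))
    filter_upwards [hnear ha, hnear hb] with p' ha' hb' x hx
    exact ⟨(neg_le_neg hb').trans hx.2.1, hx.2.2.trans ha'⟩

-- Otherwise `θ * x` is a relation for some nonzero `θ * x` with `0 ≤ θ ≤ 1`, and `x - θ * x` is a
-- shorter point of the polytope.
theorem exists_forall_pos_mul_leastNormLevel {E : Type*} [AddCommGroup E] [Module ℝ E]
    (u : ι → Module.Dual ℝ E) (ha : 0 ≤ a) (hb : 0 ≤ b) :
    ∃ Y, ∀ i, leastNormLevel (relations u) a b i ≠ 0 →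
      0 < leastNormLevel (relations u) a b i * u i Y := by
  set x := leastNormLevel (relations u) a b with hx
  refine (exists_forall_pos_mul_or_exists_mul_mem_relations x u).resolve_right ?_
  rintro ⟨θ, hθ, hne, hrel⟩
  have hmem := (leastNormLevel_spec (isClosed_relations u) ha hb).1
  rw [← hx] at hmem
  have hmul (i) : (x - θ * x) i = (1 - θ i) * x i := (one_sub_mul _ _).symm
  have hshort : x - θ * x ∈ levelPolytope (relations u) a b := by
    refine ⟨?_, fun i => ?_, fun i => ?_⟩
    · rw [Set.mem_ofPred_eq, sub_right_comm]
      exact sub_mem hmem.1 hrel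
    · rw [hmul]
      have := hmem.2.1 i
      have := hb i
      simp only [Pi.neg_apply, Pi.zero_apply] at *
      nlinarith [(hθ i).1, (hθ i).2]
    · rw [hmul]
      have := hmem.2.2 i
      have := ha i
      simp only [Pi.zero_apply] at *
      nlinarith [(hθ i).1, (hθ i).2]
  refine (leastNormLevel_dotProduct_self_lt (isClosed_relations u) ha hb hshort ?_).not_ge
    (dotProduct_self_mono fun i => ?_)
  · rwa [← hx, ne_eq, sub_eq_self]
  · rw [hmul, abs_mul]
    refine mul_le_of_le_one_left (abs_nonneg _) (abs_le.2 ⟨?_, ?_⟩) <;>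
      linarith [(hθ i).1, (hθ i).2]

-- A relation `x - (a - b)` is nonpositive where `u i Y > 0` and nonnegative where `u i Y < 0`.
theorem eq_sub_of_mem_levelPolytope {E : Type*} [AddCommGroup E] [Module ℝ E]
    {u : ι → Module.Dual ℝ E} {Y : E}
    (hY : ∀ i, (a i ≠ 0 → 0 < u i Y) ∧ (b i ≠ 0 → u i Y < 0)) {x : ι → ℝ}
    (hx : x ∈ levelPolytope (relations u) a b) : x = a - b := by
  obtain ⟨hrel, hbx, hxa⟩ := hx
  have hle (i) : (x - (a - b)) i * u i Y ≤ 0 ∧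
      ((x - (a - b)) i * u i Y = 0 → (x - (a - b)) i = 0) := by
    have hbx := hbx i
    have hxa := hxa i
    simp only [Pi.sub_apply, Pi.neg_apply] at hbx hxa ⊢
    rcases lt_trichotomy (u i Y) 0 with hneg | hzero | hpos
    · have : a i = 0 := by_contra fun h => ((hY i).1 h).not_gt hneg
      exact ⟨mul_nonpos_of_nonneg_of_nonpos (by linarith) hneg.le,
        fun h => (mul_eq_zero.1 h).resolve_right hneg.ne⟩
    · have : a i = 0 := by_contra fun h => ((hY i).1 h).ne' hzero
      have : b i = 0 := by_contra fun h => ((hY i).2 h).ne hzero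
      exact ⟨by rw [hzero, mul_zero], fun _ => by linarith⟩
    · have : b i = 0 := by_contra fun h => ((hY i).2 h).not_gt hpos
      exact ⟨mul_nonpos_of_nonpos_of_nonneg (by linarith) hpos.le,
        fun h => (mul_eq_zero.1 h).resolve_right hpos.ne'⟩
  have hsum : ∑ i, (x - (a - b)) i * u i Y = 0 := by
    simpa using DFunLike.congr_fun (mem_relations.1 hrel) Y
  rw [Finset.sum_eq_zero_iff_of_nonpos fun i _ => (hle i).1] at hsum
  exact sub_eq_zero.1 (funext fun i => (hle i).2 (hsum i (Finset.mem_univ i)))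

end LevelPolytope

/-! ### Contraction of one coordinate pair -/

section LargerRoot

/-- The larger root of `X² - y X - c`. If `‖z‖² - ‖w‖² = y` and `‖z‖² ‖w‖² = c`, then `‖z‖²` is
`largerRoot y c` and `‖w‖²` is `largerRoot (-y) c`. -/
noncomputable def largerRoot (y c : ℝ) : ℝ := (√(y ^ 2 + 4 * c) + y) / 2

variable {y c : ℝ}

lemma abs_le_sqrt_sq_add (hc : 0 ≤ c) : |y| ≤ √(y ^ 2 + 4 * c) :=
  Real.abs_le_sqrt (by linarith)

lemma largerRoot_nonneg (hc : 0 ≤ c) : 0 ≤ largerRoot y c := by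
  have := (neg_abs_le y).trans' (neg_le_neg (abs_le_sqrt_sq_add hc))
  rw [largerRoot]
  linarith

lemma largerRoot_sub_largerRoot_neg (y c : ℝ) : largerRoot y c - largerRoot (-y) c = y := by
  rw [largerRoot, largerRoot, neg_sq]
  ring

lemma largerRoot_mul_largerRoot_neg (hc : 0 ≤ c) : largerRoot y c * largerRoot (-y) c = c := by
  have := Real.sq_sqrt (by positivity : 0 ≤ y ^ 2 + 4 * c)
  rw [largerRoot, largerRoot, neg_sq]
  linear_combination this / 4

lemma largerRoot_zero_right (y : ℝ) : largerRoot y 0 = (|y| + y) / 2 := by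
  rw [largerRoot, mul_zero, add_zero, Real.sqrt_sq_eq_abs]

lemma largerRoot_sub_mul {a b : ℝ} (h : 0 ≤ a + b) : largerRoot (a - b) (a * b) = a := by
  rw [largerRoot, show (a - b) ^ 2 + 4 * (a * b) = (a + b) ^ 2 by ring, Real.sqrt_sq h]
  ring

lemma largerRoot_le {a : ℝ} (hy : y ≤ 2 * a) (h : y * a + c ≤ a ^ 2) : largerRoot y c ≤ a := by
  have : √(y ^ 2 + 4 * c) ≤ 2 * a - y := Real.sqrt_le_iff.2 ⟨by linarith, by linarith⟩
  rw [largerRoot]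
  linarith

lemma continuous_largerRoot : Continuous fun q : ℝ × ℝ => largerRoot q.1 q.2 := by
  unfold largerRoot
  fun_prop

end LargerRoot

section Rescale

variable {E : Type*} [NormedAddCommGroup E] [NormedSpace ℝ E]

/-- The vector of norm `r` in the direction of `z`; it is `0` if `z = 0`. -/
noncomputable def rescale (r : ℝ) (z : E) : E := (r / ‖z‖) • z

lemma norm_rescale {r : ℝ} {z : E} (hr : 0 ≤ r) (hrz : r ≤ ‖z‖) : ‖rescale r z‖ = r := by
  rw [rescale, norm_smul, Real.norm_of_nonneg (div_nonneg hr (norm_nonneg z))]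
  exact div_mul_cancel_of_imp fun hz => (hrz.trans hz.le).antisymm hr

lemma rescale_norm (z : E) : rescale ‖z‖ z = z := by
  rcases eq_or_ne z 0 with rfl | hz
  · rw [rescale, smul_zero]
  · rw [rescale, div_self (norm_ne_zero_iff.2 hz), one_smul]

lemma continuous_rescale {X : Type*} [TopologicalSpace X] {r : X → ℝ} {f : X → E}
    (hr : Continuous r) (hf : Continuous f) (hr₀ : ∀ x, 0 ≤ r x) (hrf : ∀ x, r x ≤ ‖f x‖) :
    Continuous fun x => rescale (r x) (f x) := by
  refine continuous_iff_continuousAt.2 fun x => ?_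
  by_cases hx : f x = 0
  · have hlim : Tendsto (fun x' => ‖f x'‖) (𝓝 x) (𝓝 0) := by
      simpa only [hx, norm_zero] using hf.norm.tendsto x
    rw [ContinuousAt, show rescale (r x) (f x) = 0 by rw [hx, rescale, smul_zero]]
    exact squeeze_zero_norm (fun x' => (norm_rescale (hr₀ x') (hrf x')).trans_le (hrf x')) hlim
  · exact (hr.continuousAt.div hf.norm.continuousAt (norm_ne_zero_iff.2 hx)).smul hf.continuousAt

lemma rescale_mul_rescale (r s : ℝ) (z w : ℂ) :
    rescale r z * rescale s w = rescale (r * s) (z * w) := by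
  rw [rescale, rescale, rescale, smul_mul_smul_comm, norm_mul, mul_div_mul_comm]

lemma rescale_mul_of_norm_eq_one (r : ℝ) (z : ℂ) {ζ : ℂ} (hζ : ‖ζ‖ = 1) :
    rescale r (z * ζ) = rescale r z * ζ := by
  rw [rescale, rescale, norm_mul, hζ, mul_one, smul_mul_assoc]

lemma rescale_mul_norm (r : ℝ) (z : E) : rescale (r * ‖z‖) z = r • z := by
  rcases eq_or_ne z 0 with rfl | hz
  · rw [rescale, smul_zero, smul_zero]
  · rw [rescale, mul_div_cancel_right₀ r (norm_ne_zero_iff.2 hz)]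

end Rescale

/-- The first coordinate of the pair obtained from `(z, w)` by moving `‖z‖² - ‖w‖²` linearly to `d`
and multiplying `z w` by `√(1 - t)`, without changing the phases. By symmetry the second coordinate
is `contractCoord t (-d) w z`. -/
noncomputable def contractCoord (t d : ℝ) (z w : ℂ) : ℂ :=
  rescale (√(largerRoot ((1 - t) * (‖z‖ ^ 2 - ‖w‖ ^ 2) + t * d)
    ((1 - t) * (‖z‖ ^ 2 * ‖w‖ ^ 2)))) z

section ContractCoord

variable {t d : ℝ} {z w : ℂ}

lemma contractCoord_of_sub_eq (h : (1 - t) * (‖z‖ ^ 2 - ‖w‖ ^ 2) + t * d = ‖z‖ ^ 2 - ‖w‖ ^ 2)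
    (h' : (1 - t) * (‖z‖ ^ 2 * ‖w‖ ^ 2) = ‖z‖ ^ 2 * ‖w‖ ^ 2) : contractCoord t d z w = z := by
  rw [contractCoord, h, h', largerRoot_sub_mul (by positivity), Real.sqrt_sq (norm_nonneg z),
    rescale_norm]

lemma contractCoord_zero (d : ℝ) (z w : ℂ) : contractCoord 0 d z w = z :=
  contractCoord_of_sub_eq (by ring) (by ring)

lemma contractCoord_mul_of_norm_eq_one (t d : ℝ) (z w : ℂ) {ζ η : ℂ} (hζ : ‖ζ‖ = 1)
    (hη : ‖η‖ = 1) : contractCoord t d (z * ζ) (w * η) = contractCoord t d z w * ζ := by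
  simp only [contractCoord, norm_mul, hζ, hη, mul_one, rescale_mul_of_norm_eq_one _ _ hζ]

lemma pos_of_contractCoord_one_ne_zero (h : contractCoord 1 d z w ≠ 0) : 0 < d := by
  contrapose! h
  rw [contractCoord, sub_self, zero_mul, zero_mul, one_mul, zero_add, largerRoot_zero_right,
    abs_of_nonpos h, neg_add_cancel, zero_div, Real.sqrt_zero, rescale, zero_div, zero_smul]

lemma sqrt_largerRoot_le_norm (ht : t ∈ Set.Icc 0 1) (hd : d ≤ ‖z‖ ^ 2) (w : ℂ) :
    √(largerRoot ((1 - t) * (‖z‖ ^ 2 - ‖w‖ ^ 2) + t * d) ((1 - t) * (‖z‖ ^ 2 * ‖w‖ ^ 2))) ≤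
      ‖z‖ := by
  have ht₁ := sub_nonneg.2 ht.2
  have htd := mul_le_mul_of_nonneg_left hd ht.1
  refine Real.sqrt_le_iff.2 ⟨norm_nonneg z, largerRoot_le ?_ ?_⟩
  · nlinarith [mul_nonneg ht₁ (sq_nonneg ‖w‖), sq_nonneg ‖z‖]
  · nlinarith [mul_le_mul_of_nonneg_right htd (sq_nonneg ‖z‖)]

lemma norm_contractCoord_sq (ht : t ∈ Set.Icc 0 1) (hd : d ≤ ‖z‖ ^ 2) (w : ℂ) :
    ‖contractCoord t d z w‖ ^ 2 =
      largerRoot ((1 - t) * (‖z‖ ^ 2 - ‖w‖ ^ 2) + t * d) ((1 - t) * (‖z‖ ^ 2 * ‖w‖ ^ 2)) := by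
  have ht₁ := sub_nonneg.2 ht.2
  rw [contractCoord, norm_rescale (Real.sqrt_nonneg _) (sqrt_largerRoot_le_norm ht hd w),
    Real.sq_sqrt (largerRoot_nonneg (by positivity))]

lemma contractCoord_swap_level (t d : ℝ) (z w : ℂ) :
    (1 - t) * (‖w‖ ^ 2 - ‖z‖ ^ 2) + t * -d = -((1 - t) * (‖z‖ ^ 2 - ‖w‖ ^ 2) + t * d) := by
  ring

lemma norm_contractCoord_sq_sub (ht : t ∈ Set.Icc 0 1) (hdz : d ≤ ‖z‖ ^ 2) (hdw : -‖w‖ ^ 2 ≤ d) :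
    ‖contractCoord t d z w‖ ^ 2 - ‖contractCoord t (-d) w z‖ ^ 2 =
      (1 - t) * (‖z‖ ^ 2 - ‖w‖ ^ 2) + t * d := by
  rw [norm_contractCoord_sq ht hdz, norm_contractCoord_sq ht (neg_le.1 hdw),
    contractCoord_swap_level, mul_comm (‖w‖ ^ 2), largerRoot_sub_largerRoot_neg]

lemma contractCoord_mul_contractCoord (ht : t ≤ 1) (d : ℝ) (z w : ℂ) :
    contractCoord t d z w * contractCoord t (-d) w z = √(1 - t) • (z * w) := by
  have ht₁ := sub_nonneg.2 ht
  have hc : 0 ≤ (1 - t) * (‖z‖ ^ 2 * ‖w‖ ^ 2) := by positivity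
  rw [contractCoord, contractCoord, contractCoord_swap_level, mul_comm (‖w‖ ^ 2),
    rescale_mul_rescale, ← Real.sqrt_mul (largerRoot_nonneg hc), largerRoot_mul_largerRoot_neg hc,
    ← mul_pow, ← norm_mul, Real.sqrt_mul ht₁, Real.sqrt_sq (norm_nonneg _), rescale_mul_norm]

end ContractCoord

lemma continuous_contractCoord {X : Type*} [TopologicalSpace X] {t d : X → ℝ} {z w : X → ℂ}
    (ht : Continuous t) (hd : Continuous d) (hz : Continuous z) (hw : Continuous w)
    (ht₀₁ : ∀ x, t x ∈ Set.Icc 0 1) (hdz : ∀ x, d x ≤ ‖z x‖ ^ 2) :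
    Continuous fun x => contractCoord (t x) (d x) (z x) (w x) :=
  continuous_rescale
    (continuous_largerRoot.comp (Continuous.prodMk (by fun_prop) (by fun_prop))).sqrt hz
    (fun _ => Real.sqrt_nonneg _) fun x => sqrt_largerRoot_le_norm (ht₀₁ x) (hdz x) (w x)

/-! ### The fibre of the natural morphism over the origin -/

section NullCone

variable {N : ℕ} (K : Subtorus N)

lemma u_apply (i : Fin N) (Y : K.lie) : K.u i Y = Y.1 i := rfl

/-- The null cone: the points that some one-parameter subgroup `t ↦ Exp (√-1 t Y)` of `K_ℂ` moves
to `0` as `t → ∞`. It multiplies `z_i` by `exp (-2π t Y_i)` and `w_i` by `exp (2π t Y_i)`. -/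
def nullCone : Set (HSpace N) :=
  {p | ∃ Y : K.lie, ∀ i, (p.1 i ≠ 0 → 0 < K.u i Y) ∧ (p.2 i ≠ 0 → K.u i Y < 0)}

lemma fst_eq_zero_or_snd_eq_zero_of_mem_nullCone {p : HSpace N} (hp : p ∈ nullCone K)
    (i : Fin N) : p.1 i = 0 ∨ p.2 i = 0 := by
  obtain ⟨Y, hY⟩ := hp
  by_contra! hi
  exact ((hY i).1 hi.1).asymm ((hY i).2 hi.2)

lemma tendsto_mul_exp_of_neg (r : ℝ) {c : ℝ} (hc : r ≠ 0 → c < 0) :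
    Tendsto (fun t : ℝ => r * Real.exp (t * c)) atTop (𝓝 0) := by
  rcases eq_or_ne r 0 with rfl | hr
  · simp only [zero_mul, tendsto_const_nhds]
  · rw [← mul_zero r]
    exact (Real.tendsto_exp_atBot.comp (tendsto_id.atTop_mul_const_of_neg (hc hr))).const_mul r

lemma zero_mem_closure_orbitC_of_mem_nullCone {p : HSpace N} (hp : p ∈ nullCone K) :
    0 ∈ closure (orbitC K p) := by
  obtain ⟨Y, hY⟩ := hp
  let γ : ℝ → HSpace N := fun t => actC (toComplexTorus 1 * expI (t • Y.1)) p
  have hγ : Tendsto γ atTop (𝓝 0) := by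
    refine Tendsto.prodMk_nhds (tendsto_pi_nhds.2 fun i => ?_) (tendsto_pi_nhds.2 fun i => ?_) <;>
      refine tendsto_zero_iff_norm_tendsto_zero.2 ?_
    · refine (tendsto_mul_exp_of_neg ‖p.1 i‖ (c := -(2 * Real.pi * Y.1 i)) fun h => ?_).congr
        fun t => ?_
      · exact neg_lt_zero.2 (mul_pos Real.two_pi_pos ((hY i).1 (norm_ne_zero_iff.1 h)))
      · refine Eq.trans ?_ (actC_norm_fst 1 (t • Y.1) p i).symm
        rw [Pi.smul_apply, smul_eq_mul, mul_neg, mul_left_comm t]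
    · refine (tendsto_mul_exp_of_neg ‖p.2 i‖ (c := 2 * Real.pi * Y.1 i) fun h => ?_).congr
        fun t => ?_
      · exact mul_neg_of_pos_of_neg Real.two_pi_pos ((hY i).2 (norm_ne_zero_iff.1 h))
      · refine Eq.trans ?_ (actC_norm_snd 1 (t • Y.1) p i).symm
        rw [Pi.smul_apply, smul_eq_mul, mul_left_comm t]
  exact mem_closure_of_tendsto hγ (Eventually.of_forall fun t =>
    ⟨_, ⟨1, one_mem _, _, K.lie.smul_mem t Y.2, rfl⟩, rfl⟩)

lemma mem_nullCone_of_zero_mem_closure_orbitC {p : HSpace N} (hp : 0 ∈ closure (orbitC K p)) :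
    p ∈ nullCone K := by
  have hshrink : ∀ᶠ r : HSpace N in 𝓝 0, ∀ i,
      (p.1 i ≠ 0 → ‖r.1 i‖ < ‖p.1 i‖) ∧ (p.2 i ≠ 0 → ‖r.2 i‖ < ‖p.2 i‖) := by
    refine eventually_all.2 fun i => .and ?_ ?_ <;>
      refine eventually_imp_distrib_left.2 fun hi => ?_
    · exact (by fun_prop : Continuous fun r : HSpace N => ‖r.1 i‖).tendsto 0
        |>.eventually_lt_const (by simpa using hi)
    · exact (by fun_prop : Continuous fun r : HSpace N => ‖r.2 i‖).tendsto 0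
        |>.eventually_lt_const (by simpa using hi)
  obtain ⟨_, ⟨_, ⟨κ, -, Y, hY, rfl⟩, rfl⟩, hr⟩ :=
    ((mem_closure_iff_frequently.1 hp).and_eventually hshrink).exists
  refine ⟨⟨Y, hY⟩, fun i => ⟨fun hi => ?_, fun hi => ?_⟩⟩ <;> rw [u_apply]
  · have := (hr i).1 hi
    rw [actC_norm_fst, mul_lt_iff_lt_one_right (norm_pos_iff.2 hi), Real.exp_lt_one_iff] at this
    exact pos_of_mul_pos_right (neg_lt_zero.1 this) Real.two_pi_pos.le
  · have := (hr i).2 hi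
    rw [actC_norm_snd, mul_lt_iff_lt_one_right (norm_pos_iff.2 hi), Real.exp_lt_one_iff] at this
    exact neg_of_mul_neg_right this Real.two_pi_pos.le

theorem zero_mem_closure_orbitC_iff {p : HSpace N} :
    0 ∈ closure (orbitC K p) ↔ p ∈ nullCone K :=
  ⟨mem_nullCone_of_zero_mem_closure_orbitC K, zero_mem_closure_orbitC_of_mem_nullCone K⟩

theorem naturalMorphism_mk_eq_origin_iff {α : Module.Dual ℝ K.lie} (p : levelSet K α 0) :
    naturalMorphism K α 0 (X.mk K p) = origin K ↔ p.1 ∈ nullCone K := by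
  rw [← zero_mem_closure_orbitC_iff, naturalMorphism, Equiv.symm_apply_eq]
  constructor
  · intro h
    obtain ⟨q, hq, hq₀⟩ := exists_mu1_zero K p.1
    have hqβ : q ∈ levelSet K 0 0 := ⟨hq₀, (muC_of_mem_closure K hq).trans p.2.2⟩
    have hGIT : toGIT K 0 0 (X.mk K ⟨q, hqβ⟩) = gitMap K α 0 (toGIT K α 0 (X.mk K p)) :=
      Quot.sound ⟨q, ⟨subset_closure (mem_orbitC_self K q), hq⟩, mem_semistable_zero K hqβ.2⟩
    obtain ⟨κ, hκ, hκq⟩ := Quotient.exact ((toGIT_zero_bijective K 0).1 (hGIT.trans h))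
    replace hκq : act κ q = 0 := hκq
    rw [← hκq]
    exact closure_orbitC_subset K hq (subset_closure (act_mem_orbitC K hκ q))
  · exact fun h => Quot.sound ⟨0, ⟨h, subset_closure (mem_orbitC_self K 0)⟩,
      mem_semistable_zero K ((muC_of_mem_closure K h).trans p.2.2)⟩

end NullCone

/-! ### The deformation retraction -/

section Retraction

variable {N : ℕ}

/-- The squared absolute values of the coordinates of a vector. -/
noncomputable def absSq (z : Fin N → ℂ) : Fin N → ℝ := fun i => ‖z i‖ ^ 2

lemma absSq_nonneg (z : Fin N → ℂ) : 0 ≤ absSq z := fun i => sq_nonneg ‖z i‖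

lemma absSq_ne_zero {z : Fin N → ℂ} {i : Fin N} : absSq z i ≠ 0 ↔ z i ≠ 0 := by
  rw [absSq, ne_eq, sq_eq_zero_iff, norm_eq_zero]

lemma continuous_absSq : Continuous (absSq : (Fin N → ℂ) → Fin N → ℝ) := by
  unfold absSq
  fun_prop

lemma absSq_act_fst (ζ : Fin N → Circle) (p : HSpace N) : absSq (act ζ p).1 = absSq p.1 :=
  funext fun i => by rw [absSq, absSq, norm_act_fst]

lemma absSq_act_snd (ζ : Fin N → Circle) (p : HSpace N) : absSq (act ζ p).2 = absSq p.2 :=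
  funext fun i => by rw [absSq, absSq, norm_act_snd]

/-- The map `HSpace N → HSpace N` acting by `contractCoord t (x i)` on the `i`-th pair of
coordinates: it moves `‖z i‖ ^ 2 - ‖w i‖ ^ 2` to `x i` and the products `z i * w i` to `0`. -/
noncomputable def contract (x : Fin N → ℝ) (t : ℝ) (p : HSpace N) : HSpace N :=
  (fun i => contractCoord t (x i) (p.1 i) (p.2 i), fun i => contractCoord t (-x i) (p.2 i) (p.1 i))

lemma contract_zero (x : Fin N → ℝ) (p : HSpace N) : contract x 0 p = p :=
  Prod.ext (funext fun _ => contractCoord_zero _ _ _) (funext fun _ => contractCoord_zero _ _ _)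

lemma contract_act (x : Fin N → ℝ) (t : ℝ) (ζ : Fin N → Circle) (p : HSpace N) :
    contract x t (act ζ p) = act ζ (contract x t p) := by
  have hinv (i) : ‖(((toComplexTorus ζ i)⁻¹ : ℂˣ) : ℂ)‖ = 1 := by
    rw [Units.val_inv_eq_inv_val, norm_inv, norm_toComplexTorus, inv_one]
  exact Prod.ext
    (funext fun i => contractCoord_mul_of_norm_eq_one _ _ _ _ (norm_toComplexTorus ζ i) (hinv i))
    (funext fun i => contractCoord_mul_of_norm_eq_one _ _ _ _ (hinv i) (norm_toComplexTorus ζ i))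

lemma contract_sub_eq_self {p : HSpace N} (hp : ∀ i, p.1 i = 0 ∨ p.2 i = 0) (t : ℝ) :
    contract (absSq p.1 - absSq p.2) t p = p := by
  have hmul (i) : ‖p.1 i‖ ^ 2 * ‖p.2 i‖ ^ 2 = 0 := by
    rcases hp i with h | h <;> rw [h, norm_zero] <;> ring
  refine Prod.ext (funext fun i => contractCoord_of_sub_eq ?_ ?_)
    (funext fun i => contractCoord_of_sub_eq ?_ ?_) <;>
    simp only [hmul, mul_comm (‖p.2 i‖ ^ 2), mul_zero, absSq, Pi.sub_apply] <;> ring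

variable {x : Fin N → ℝ} {t : ℝ} {p : HSpace N}

lemma absSq_contract_sub {R : Submodule ℝ (Fin N → ℝ)}
    (hx : x ∈ levelPolytope R (absSq p.1) (absSq p.2)) (ht : t ∈ Set.Icc 0 1) :
    absSq (contract x t p).1 - absSq (contract x t p).2 =
      (1 - t) • (absSq p.1 - absSq p.2) + t • x :=
  funext fun i => norm_contractCoord_sq_sub ht (hx.2.2 i) (hx.2.1 i)

variable (K : Subtorus N)

lemma mu1_eq_of_sub_mem_relations {q : HSpace N}
    (h : (absSq q.1 - absSq q.2) - (absSq p.1 - absSq p.2) ∈ relations K.u) :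
    mu1 K q = mu1 K p :=
  congrArg (Real.pi • ·) (LinearMap.sub_mem_ker_iff.1 h)

lemma muC_eq_smul {q : HSpace N} {c : ℝ}
    (h : ∀ i, q.1 i * q.2 i = c • (p.1 i * p.2 i)) : muC K q = c • muC K p := by
  have hterm (i) : (K.u i).smulRight (q.1 i * q.2 i) = c • (K.u i).smulRight (p.1 i * p.2 i) := by
    ext Y
    rw [h, LinearMap.smul_apply, LinearMap.smulRight_apply, LinearMap.smulRight_apply, smul_comm]
  simp only [muC, hterm, ← Finset.smul_sum, smul_comm c]

lemma contract_mem_levelSet {α : Module.Dual ℝ K.lie} (hp : p ∈ levelSet K α 0)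
    (hx : x ∈ levelPolytope (relations K.u) (absSq p.1) (absSq p.2)) (ht : t ∈ Set.Icc 0 1) :
    contract x t p ∈ levelSet K α 0 := by
  constructor
  · rw [← hp.1]
    apply mu1_eq_of_sub_mem_relations
    have hrel : x - (absSq p.1 - absSq p.2) ∈ relations K.u := hx.1
    rw [absSq_contract_sub hx ht]
    convert Submodule.smul_mem _ t hrel using 1
    module
  · rw [muC_eq_smul K fun i => contractCoord_mul_contractCoord ht.2 (x i) (p.1 i) (p.2 i), hp.2,
      smul_zero]

/-- The least-norm value that `‖z i‖ ^ 2 - ‖w i‖ ^ 2` can be given by shrinking the coordinates of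
`p = (z, w)` at constant real moment map. -/
noncomputable def reducedLevel (p : HSpace N) : Fin N → ℝ :=
  leastNormLevel (relations K.u) (absSq p.1) (absSq p.2)

lemma reducedLevel_mem (p : HSpace N) :
    reducedLevel K p ∈ levelPolytope (relations K.u) (absSq p.1) (absSq p.2) :=
  (leastNormLevel_spec (isClosed_relations K.u) (absSq_nonneg _) (absSq_nonneg _)).1

lemma continuous_reducedLevel : Continuous (reducedLevel K) :=
  continuous_leastNormLevel (isClosed_relations K.u) (continuous_absSq.comp continuous_fst)
    (continuous_absSq.comp continuous_snd) (fun _ => absSq_nonneg _) fun _ => absSq_nonneg _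

lemma reducedLevel_act (ζ : Fin N → Circle) (p : HSpace N) :
    reducedLevel K (act ζ p) = reducedLevel K p := by
  rw [reducedLevel, reducedLevel, absSq_act_fst, absSq_act_snd]

lemma reducedLevel_of_mem_nullCone (hp : p ∈ nullCone K) :
    reducedLevel K p = absSq p.1 - absSq p.2 := by
  obtain ⟨Y, hY⟩ := hp
  refine eq_sub_of_mem_levelPolytope (Y := Y) (fun i => ?_) (reducedLevel_mem K p)
  simpa only [absSq_ne_zero] using hY i

lemma contract_reducedLevel_one_mem_nullCone (p : HSpace N) :
    contract (reducedLevel K p) 1 p ∈ nullCone K := by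
  obtain ⟨Y, hY⟩ := exists_forall_pos_mul_leastNormLevel K.u (absSq_nonneg p.1) (absSq_nonneg p.2)
  refine ⟨Y, fun i => ⟨fun hi => ?_, fun hi => ?_⟩⟩
  · have hpos := pos_of_contractCoord_one_ne_zero hi
    exact pos_of_mul_pos_right (hY i hpos.ne') hpos.le
  · have hneg := neg_pos.1 (pos_of_contractCoord_one_ne_zero hi)
    exact neg_of_mul_pos_right (hY i hneg.ne) hneg.le

variable {α : Module.Dual ℝ K.lie}

/-- The contraction of a level set of the hyperkähler moment map towards the null cone. -/
noncomputable def contractLevel (t : unitInterval) (p : levelSet K α 0) : levelSet K α 0 :=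
  ⟨contract (reducedLevel K p) t p, contract_mem_levelSet K p.2 (reducedLevel_mem K p) t.2⟩

lemma continuous_contractLevel :
    Continuous fun q : unitInterval × levelSet K α 0 => contractLevel K q.1 q.2 := by
  have hlevel := continuous_pi_iff.1 (continuous_reducedLevel K)
  have ht : Continuous fun q : unitInterval × levelSet K α 0 => (q.1 : ℝ) := by fun_prop
  refine Continuous.subtype_mk (Continuous.prodMk (continuous_pi fun i => ?_)
    (continuous_pi fun i => ?_)) _
  · exact continuous_contractCoord ht ((hlevel i).comp (by fun_prop)) (by fun_prop) (by fun_prop)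
      (fun q => q.1.2) fun q => (reducedLevel_mem K q.2).2.2 i
  · exact continuous_contractCoord ht ((hlevel i).comp (by fun_prop)).neg (by fun_prop)
      (by fun_prop) (fun q => q.1.2) fun q => neg_le.1 ((reducedLevel_mem K q.2).2.1 i)

lemma contractLevel_zero (p : levelSet K α 0) : contractLevel K 0 p = p :=
  Subtype.ext (contract_zero _ _)

lemma contractLevel_of_mem_nullCone (t : unitInterval) {p : levelSet K α 0}
    (hp : p.1 ∈ nullCone K) : contractLevel K t p = p :=
  Subtype.ext ((congrArg (contract · t p.1) (reducedLevel_of_mem_nullCone K hp)).trans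
    (contract_sub_eq_self (fst_eq_zero_or_snd_eq_zero_of_mem_nullCone K hp) t))

lemma contractLevel_actLevel (t : unitInterval) (ζ : Fin N → Circle) (p : levelSet K α 0) :
    contractLevel K t (actLevel K ζ p) = actLevel K ζ (contractLevel K t p) :=
  Subtype.ext <| by
    simp only [contractLevel, actLevel, reducedLevel_act, contract_act]

/-- The self-map of `X(α, 0)` induced by `contractLevel`. -/
noncomputable def contractX (t : unitInterval) : X K α 0 → X K α 0 :=
  Quotient.map (contractLevel K t) <| by
    rintro p q ⟨κ, hκ, hpq⟩
    obtain rfl : actLevel K κ p = q := Subtype.ext hpq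
    exact ⟨κ, hκ, congrArg Subtype.val (contractLevel_actLevel K t κ p).symm⟩

lemma isQuotientMap_mk : IsQuotientMap (X.mk K : levelSet K α 0 → X K α 0) :=
  isQuotientMap_quotient_mk'

lemma continuous_contractX : Continuous fun q : unitInterval × X K α 0 => contractX K q.1 q.2 :=
  (isQuotientMap_mk K).continuous_lift_prod_right
    ((isQuotientMap_mk K).continuous.comp (continuous_contractLevel K))

theorem isEquivariantDeformationRetract_fibre (α : Module.Dual ℝ K.lie) :
    IsEquivariantDeformationRetract K.quotientTorus
      (naturalMorphism K α 0 ⁻¹' {origin K}) := by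
  refine ⟨⟨_, continuous_contractX K⟩, fun y => ?_, fun y => ?_, fun t y hy => ?_, fun t g y => ?_⟩
    <;> obtain ⟨p, rfl⟩ := (isQuotientMap_mk K).surjective y
  · exact congrArg (X.mk K) (contractLevel_zero K p)
  · exact (naturalMorphism_mk_eq_origin_iff K _).2 (contract_reducedLevel_one_mem_nullCone K p)
  · exact congrArg (X.mk K) (contractLevel_of_mem_nullCone K t
      ((naturalMorphism_mk_eq_origin_iff K p).1 hy))
  · obtain ⟨ζ, rfl⟩ := QuotientGroup.mk_surjective g
    exact congrArg (X.mk K) (contractLevel_actLevel K t ζ p)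

end Retraction

/-! ### The compact components -/

section Signs

variable {ι E : Type*} [Finite ι] [AddCommGroup E] [Module ℝ E]

lemma eventually_add_mul_ne_zero_and_pos_mul (y : ℝ) {z : ℝ} (hz : z ≠ 0) :
    ∀ᶠ t : ℝ in 𝓝[>] 0, y + t * z ≠ 0 ∧ (y ≠ 0 → 0 < y * (y + t * z)) := by
  rcases eq_or_ne y 0 with rfl | hy
  · filter_upwards [self_mem_nhdsWithin] with t (ht : 0 < t)
    exact ⟨by simpa only [zero_add] using mul_ne_zero ht.ne' hz, fun h => absurd rfl h⟩
  · have hlim : ContinuousAt (fun t : ℝ => y * (y + t * z)) 0 := by fun_prop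
    filter_upwards [nhdsWithin_le_nhds (hlim.eventually_const_lt (u := 0)
      (by simpa only [zero_mul, add_zero, mul_self_pos] using hy))] with t ht
    exact ⟨right_ne_zero_of_mul ht.ne', fun _ => ht⟩

lemma exists_forall_ne_zero_and_pos_mul {f : ι → Module.Dual ℝ E} (hf : ∀ i, f i ≠ 0) (Y : E) :
    ∃ Y', ∀ i, f i Y' ≠ 0 ∧ (f i Y ≠ 0 → 0 < f i Y * f i Y') := by
  obtain ⟨Z, hZ⟩ := Module.Dual.exists_forall_ne_zero_of_forall_exists f fun i =>
    DFunLike.ne_iff.1 (hf i)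
  obtain ⟨t, ht⟩ :=
    (eventually_all.2 fun i => eventually_add_mul_ne_zero_and_pos_mul (f i Y) (hZ i)).exists
  exact ⟨Y + t • Z, fun i => by simpa only [map_add, map_smul, smul_eq_mul] using ht i⟩

lemma exists_intUnits_mul_pos {y : ℝ} (hy : y ≠ 0) : ∃ s : ℤˣ, 0 < ((s : ℤ) : ℝ) * y := by
  rcases hy.lt_or_gt with hy | hy
  · exact ⟨-1, by simpa using hy⟩
  · exact ⟨1, by simpa using hy⟩

end Signs

section Components

variable {N : ℕ} {ε : Fin N → ℤˣ} {p : HSpace N}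

/-- A vector of signs, regarded as a real vector. -/
def signVector (ε : Fin N → ℤˣ) : Fin N → ℝ := fun i => ((ε i : ℤ) : ℝ)

lemma signVector_ne_zero (ε : Fin N → ℤˣ) (i : Fin N) : signVector ε i ≠ 0 :=
  Int.cast_ne_zero.2 (ε i).ne_zero

lemma isClosed_V (ε : Fin N → ℤˣ) : IsClosed (V ε) := by
  simp only [V, Set.ofPred_and, Set.ofPred_forall]
  refine isClosed_iInter fun i => IsClosed.inter ?_ ?_ <;>
    exact isClosed_iInter fun _ => isClosed_eq (by fun_prop) continuous_const

lemma mul_eq_zero_of_mem_V (hp : p ∈ V ε) (i : Fin N) : p.1 i * p.2 i = 0 := by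
  rcases Int.units_eq_one_or (ε i) with hi | hi
  · rw [(hp i).1 hi, mul_zero]
  · rw [(hp i).2 hi, zero_mul]

lemma absSq_sub_of_mem_V (hp : p ∈ V ε) :
    absSq p.1 - absSq p.2 = signVector ε * (absSq p.1 + absSq p.2) := by
  funext i
  rcases Int.units_eq_one_or (ε i) with hi | hi
  · simp [signVector, absSq, hi, (hp i).1 hi]
  · simp [signVector, absSq, hi, (hp i).2 hi]

lemma exists_mem_V_absSq_add_eq (ε : Fin N → ℤˣ) {r : Fin N → ℝ} (hr : 0 ≤ r) :
    ∃ q ∈ V ε, absSq q.1 + absSq q.2 = r := by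
  refine ⟨(fun i => if ε i = 1 then (√(r i) : ℂ) else 0,
    fun i => if ε i = 1 then 0 else (√(r i) : ℂ)), fun i => ⟨fun hi => ?_, fun hi => ?_⟩,
    funext fun i => ?_⟩
  · exact if_pos hi
  · exact if_neg (by rw [hi]; decide)
  · by_cases hi : ε i = 1 <;> simp [absSq, hi, Real.sq_sqrt (hr i)]

lemma isCompact_setOf_absSq_add_le (c : Fin N → ℝ) :
    IsCompact {p : HSpace N | absSq p.1 + absSq p.2 ≤ c} := by
  refine ((isCompact_univ_pi fun i => isCompact_closedBall (0 : ℂ) (√(c i))).prod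
    (isCompact_univ_pi fun i => isCompact_closedBall (0 : ℂ) (√(c i)))).of_isClosed_subset
    (isClosed_le ((continuous_absSq.comp continuous_fst).add
      (continuous_absSq.comp continuous_snd)) continuous_const) fun p hp => ?_
  refine ⟨fun i _ => ?_, fun i _ => ?_⟩ <;>
    refine mem_closedBall_zero_iff.2 (Real.le_sqrt_of_sq_le (le_trans ?_ (hp i)))
  · exact le_add_of_nonneg_right (absSq_nonneg p.2 i)
  · exact le_add_of_nonneg_left (absSq_nonneg p.1 i)

variable (K : Subtorus N)

lemma mu1_apply (p : HSpace N) (Y : K.lie) :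
    mu1 K p Y = Real.pi * ∑ i, (absSq p.1 - absSq p.2) i * K.u i Y := by
  simp only [mu1, absSq, LinearMap.smul_apply, LinearMap.sum_apply, smul_eq_mul, Pi.sub_apply]

lemma muC_of_mem_V (hp : p ∈ V ε) : muC K p = 0 := by
  rw [muC_eq_smul K (p := p) (c := 0) fun i => by rw [mul_eq_zero_of_mem_V hp, smul_zero],
    zero_smul]

lemma isClosed_setOf_mu1_eq (α : Module.Dual ℝ K.lie) : IsClosed {p | mu1 K p = α} := by
  simp only [LinearMap.ext_iff, Set.ofPred_forall, mu1, LinearMap.smul_apply, LinearMap.sum_apply]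
  exact isClosed_iInter fun Y => isClosed_eq (by fun_prop) continuous_const

/-- The sign vectors of the elements of the Lie algebra of `K` whose coordinates are all
nonzero. -/
def lieSigns : Set (Fin N → ℤˣ) := {ε | ∃ Y : K.lie, ∀ i, 0 < signVector ε i * K.u i Y}

variable {K} {α : Module.Dual ℝ K.lie}

lemma pi_mul_absSq_add_le {Y : K.lie} (hY : ∀ i, 0 < signVector ε i * K.u i Y)
    (hp : p ∈ V ε) (i : Fin N) :
    Real.pi * ((absSq p.1 + absSq p.2) i * (signVector ε i * K.u i Y)) ≤ mu1 K p Y := by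
  have hnonneg (j) : 0 ≤ (absSq p.1 + absSq p.2) j * (signVector ε j * K.u j Y) :=
    mul_nonneg (add_nonneg (absSq_nonneg p.1 j) (absSq_nonneg p.2 j)) (hY j).le
  rw [mu1_apply, absSq_sub_of_mem_V hp]
  simp only [Pi.mul_apply, mul_comm (signVector ε _), mul_assoc] at hnonneg ⊢
  exact mul_le_mul_of_nonneg_left
    (Finset.single_le_sum (fun j _ => hnonneg j) (Finset.mem_univ i)) Real.pi_pos.le

lemma mem_levelSet_iff_of_mem_V (hp : p ∈ V ε) : p ∈ levelSet K α 0 ↔ mu1 K p = α :=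
  and_iff_left (muC_of_mem_V K hp)

theorem isCompact_M_of_mem_lieSigns (hε : ε ∈ lieSigns K) (α : Module.Dual ℝ K.lie) :
    IsCompact (M K α ε) := by
  obtain ⟨Y, hY⟩ := hε
  have hcompact : IsCompact ({p | mu1 K p = α} ∩ V ε) := by
    refine (isCompact_setOf_absSq_add_le fun i =>
      α Y / (Real.pi * (signVector ε i * K.u i Y))).of_isClosed_subset
      ((isClosed_setOf_mu1_eq K α).inter (isClosed_V ε)) ?_
    rintro p ⟨rfl, hpV⟩ i
    rw [le_div_iff₀ (mul_pos Real.pi_pos (hY i)), mul_left_comm]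
    exact pi_mul_absSq_add_le hY hpV i
  refine IsCompact.image ?_ (isQuotientMap_mk K).continuous
  rw [Subtype.isCompact_iff]
  convert hcompact using 1
  ext p
  simpa [and_comm] using mem_levelSet_iff_of_mem_V

lemma exists_mem_V_absSq_add_eq_add (hp : p ∈ levelSet K α 0) (hpV : p ∈ V ε) {θ : Fin N → ℝ}
    (hθ : 0 ≤ θ) (hrel : θ * signVector ε ∈ relations K.u) :
    ∃ q ∈ levelSet K α 0, q ∈ V ε ∧ absSq q.1 + absSq q.2 = absSq p.1 + absSq p.2 + θ := by
  obtain ⟨q, hqV, hq⟩ := exists_mem_V_absSq_add_eq ε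
    (add_nonneg (add_nonneg (absSq_nonneg p.1) (absSq_nonneg p.2)) hθ)
  refine ⟨q, (mem_levelSet_iff_of_mem_V hqV).2 (.trans ?_ hp.1), hqV, hq⟩
  refine mu1_eq_of_sub_mem_relations K ?_
  rwa [absSq_sub_of_mem_V hqV, absSq_sub_of_mem_V hpV, hq, ← mul_sub, add_sub_cancel_left,
    mul_comm]

lemma exists_forall_absSq_add_le (hM : IsCompact (M K α ε)) (i : Fin N) :
    ∃ B, ∀ q ∈ levelSet K α 0, q ∈ V ε → (absSq q.1 + absSq q.2) i ≤ B := by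
  let ν : X K α 0 → ℝ := Quotient.lift (fun q => (absSq q.1.1 + absSq q.1.2) i) <| by
    rintro q q' ⟨κ, -, hκ⟩
    simp only [← hκ, absSq_act_fst, absSq_act_snd]
  have hν : Continuous ν := (isQuotientMap_mk K).continuous_iff.2 <|
    (continuous_apply i).comp ((continuous_absSq.comp (by fun_prop)).add
      (continuous_absSq.comp (by fun_prop)))
  obtain ⟨B, hB⟩ := hM.bddAbove_image hν.continuousOn
  exact ⟨B, fun q hq hqV => hB ⟨_, ⟨⟨q, hq⟩, hqV, rfl⟩, rfl⟩⟩

-- Otherwise `θ * signVector ε` is a relation for some nonzero `θ ≥ 0`, and moving a point of `V ε`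
-- along it makes a coordinate of the compact set `M K α ε` unbounded.
theorem mem_lieSigns_of_isCompact_M (hM : IsCompact (M K α ε)) (hne : (M K α ε).Nonempty) :
    ε ∈ lieSigns K := by
  refine ((exists_forall_pos_mul_or_exists_mul_mem_relations (signVector ε) K.u).imp_left
    fun ⟨Y, hY⟩ => ⟨Y, fun i => hY i (signVector_ne_zero ε i)⟩).resolve_right ?_
  rintro ⟨θ, hθ, hne_zero, hrel⟩
  obtain ⟨_, p, hpV, rfl⟩ := hne
  obtain ⟨i, hi⟩ := Function.ne_iff.1 hne_zero
  have hθi : 0 < θ i := (hθ i).1.lt_of_ne' (left_ne_zero_of_mul hi)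
  obtain ⟨B, hB⟩ := exists_forall_absSq_add_le hM i
  obtain ⟨n, hn⟩ := exists_nat_gt (B / θ i)
  rw [div_lt_iff₀ hθi] at hn
  obtain ⟨q, hq, hqV, hadd⟩ := exists_mem_V_absSq_add_eq_add p.2 hpV (θ := (n : ℝ) • θ)
    (fun j => mul_nonneg n.cast_nonneg (hθ j).1)
    (by rw [smul_mul_assoc]; exact Submodule.smul_mem _ _ hrel)
  have hle := hB q hq hqV
  rw [hadd, Pi.add_apply, Pi.smul_apply, smul_eq_mul] at hle
  have := add_nonneg (absSq_nonneg p.1.1 i) (absSq_nonneg p.1.2 i)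
  exact (hn.trans_le (le_of_add_le_of_nonneg_right hle this)).false

lemma V_subset_nullCone (hε : ε ∈ lieSigns K) : V ε ⊆ nullCone K := by
  obtain ⟨Y, hY⟩ := hε
  refine fun p hp => ⟨Y, fun i => ?_⟩
  have hYi := hY i
  rcases Int.units_eq_one_or (ε i) with hi | hi
  · exact ⟨fun _ => by simpa [signVector, hi] using hYi, fun h => absurd ((hp i).1 hi) h⟩
  · exact ⟨fun h => absurd ((hp i).2 hi) h, fun _ => by simpa [signVector, hi] using hYi⟩

theorem nullCone_eq_iUnion_V (hu : ∀ i, K.u i ≠ 0) :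
    nullCone K = ⋃ ε ∈ lieSigns K, V ε := by
  refine subset_antisymm ?_ (Set.iUnion₂_subset fun ε hε => V_subset_nullCone hε)
  rintro p ⟨Y, hY⟩
  obtain ⟨Y', hY'⟩ := exists_forall_ne_zero_and_pos_mul hu Y
  choose ε hε using fun i => exists_intUnits_mul_pos (hY' i).1
  refine Set.mem_iUnion₂.2 ⟨ε, ⟨Y', hε⟩, fun i => ⟨fun hi => ?_, fun hi => ?_⟩⟩ <;>
    by_contra hne <;> have hεi := hε i
  · have hneg := (hY i).2 hne
    have hneg' := neg_of_mul_pos_right ((hY' i).2 hneg.ne) hneg.le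
    exact hneg'.asymm (by simpa [hi] using hεi)
  · have hpos := (hY i).1 hne
    have hpos' := pos_of_mul_pos_right ((hY' i).2 hpos.ne') hpos.le
    exact hpos'.asymm (by simpa [hi] using hεi)

theorem fibre_eq_iUnion_compactSigns (α : Module.Dual ℝ K.lie) (hu : ∀ i, K.u i ≠ 0) :
    naturalMorphism K α 0 ⁻¹' {origin K} = ⋃ ε ∈ compactSigns K α, M K α ε := by
  refine subset_antisymm (fun x hx => ?_) (Set.iUnion₂_subset fun ε hM => ?_)
  · obtain ⟨p, rfl⟩ := (isQuotientMap_mk K).surjective x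
    have hp := (naturalMorphism_mk_eq_origin_iff K p).1 hx
    rw [nullCone_eq_iUnion_V hu] at hp
    obtain ⟨ε, hε, hpV⟩ := Set.mem_iUnion₂.1 hp
    exact Set.mem_iUnion₂.2 ⟨ε, isCompact_M_of_mem_lieSigns hε α, p, hpV, rfl⟩
  · rintro _ ⟨p, hpV, rfl⟩
    have hε := mem_lieSigns_of_isCompact_M hM ⟨_, p, hpV, rfl⟩
    exact (naturalMorphism_mk_eq_origin_iff K p).2 (V_subset_nullCone hε hpV)

end Components

end ToricHK

theorem mainTheorem4 {N : ℕ} (K : ToricHK.Subtorus N) (α : Module.Dual ℝ K.lie) :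
    ToricHK.IsEquivariantDeformationRetract K.quotientTorus
        (ToricHK.naturalMorphism K α 0 ⁻¹' {ToricHK.origin K}) ∧
      ((∀ i, K.u i ≠ 0) →
        ToricHK.naturalMorphism K α 0 ⁻¹' {ToricHK.origin K} =
          ⋃ ε ∈ ToricHK.compactSigns K α, ToricHK.M K α ε) :=
  ⟨ToricHK.isEquivariantDeformationRetract_fibre K α, ToricHK.fibre_eq_iUnion_compactSigns α⟩
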